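/- Consider on $\mathbb{R}^2$ the perturbed incompressible viscous MHD system without magnetic diffusion $$\partial_t u+u\cdot\nabla u-\Delta u+\nabla P=b\cdot\nabla b+\partial_2 b,\qquad \partial_t b+u\cdot\nabla b=b\cdot\nabla u+\partial_2 u,\qquad \nabla\cdot u=\nabla\cdot b=0,$$ with $u=(u_1,u_2)$, $b=(b_1,b_2)$ and scalar pressure $P$. There is an absolute constant $C>0$ such that the following holds. Let $T>0$ and let $(u,b,P)$ be a smooth solution of this system on $[0,T]\times\mathbb{R}^2$ with finite energy $E_0(T)<\infty$; here it is enough smoothness that $u,b\in C^3([0,T]\times\mathbb{R}^2)$ and $P(\tau,\cdot)\in C^1(\mathbb{R}^2)$ for $0<\tau<T$, the two evolution equations being satisfied pointwise for $0<\tau<T$. For $0\le t\le T$ put $\Omega_\pm=u_1\pm b_1$ and $$E_0(t)=\sup_{0\le\tau\le t}\big(\|u(\tau)\|_{H^2}^2+\|b(\tau)\|_{H^2}^2\big)+\int_0^t\|\nabla u(\tau)\|_{H^2}^2\,d\tau,$$ $$E_1(t)=\int_0^t\|\partial_2 b(\tau)\|_{H^1}^2\,d\tau,\qquad A_\pm(t)=\int_0^t\int_{\mathbb{R}^2}|\Omega_\pm|^2\,|\partial_1^2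 b_2|^2\,dx\,d\tau .$$ Then for every $t\in[0,T]$ the quantities $E_0(t),E_1(t),A_\pm(t)$ are finite, $\partial_2u_2\,|\partial_1^2b_2|^2$ is integrable on $(0,t)\times\mathbb{R}^2$, and $$\int_0^t\int_{\mathbb{R}^2}\partial_2u_2\,|\partial_1^2 b_2|^2\,dx\,d\tau\le C\,E_0(t)\,\big(A_+(t)+A_-(t)\big)^{1/2}+C\,\big(E_0(t)^{1/2}+E_0(t)+E_0(t)^{3/2}\big)\big(E_0(t)+E_1(t)\big).$$ -/

import Mathlib

open Set MeasureTheory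
open scoped ENNReal

noncomputable section

namespace MHD

/-- The plane `ℝ²`, with coordinates `(x₁, x₂) = (x.1, x.2)` and Lebesgue measure `volume`. -/
abbrev Plane := ℝ × ℝ

/-- The standard basis of the plane. The indices `0, 1 : Fin 2` stand for the directions and
components numbered `1, 2` in the usual notation. -/
def e : Fin 2 → Plane := ![(1, 0), (0, 1)]

/-- The partial derivative of a scalar function in the direction `e i`. -/
def pd (i : Fin 2) (f : Plane → ℝ) : Plane → ℝ := fun x => fderiv ℝ f x (e i)

/-- The Laplacian `∂₁² f + ∂₂² f`. -/
def laplacian (f : Plane → ℝ) : Plane → ℝ := fun x => ∑ i, pd i (pd i f) x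

/-- The directional derivative `v · ∇ f` along a vector field `v` given by its components. -/
def advect (v : Fin 2 → Plane → ℝ) (f : Plane → ℝ) : Plane → ℝ :=
  fun x => ∑ j, v j x * pd j f x

/-- `‖f‖²` in `L²(ℝ²)`, as an extended nonnegative number. -/
def l2Sq (f : Plane → ℝ) : ℝ≥0∞ := ∫⁻ x, ‖f x‖ₑ ^ 2

/-- `‖f‖²` in `H¹(ℝ²)`, for continuously differentiable `f`. -/
def h1Sq (f : Plane → ℝ) : ℝ≥0∞ := l2Sq f + ∑ i, l2Sq (pd i f)

/-- `‖f‖²` in `H²(ℝ²)`, for twice continuously differentiable `f`. -/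
def h2Sq (f : Plane → ℝ) : ℝ≥0∞ :=
  l2Sq f + ∑ i, l2Sq (pd i f) + ∑ i, ∑ j, l2Sq (pd i (pd j f))

/-- A time-dependent scalar function: first argument time, second argument space. -/
abbrev ScalarField := ℝ → Plane → ℝ

/-- A time-dependent vector field in the plane, given by its two components. -/
abbrev VectorField := Fin 2 → ScalarField

/-- `E₀(t) = sup_{0 ≤ τ ≤ t} (‖u(τ)‖²_{H²} + ‖b(τ)‖²_{H²}) + ∫₀ᵗ ‖∇u(τ)‖²_{H²} dτ`. -/
def E₀ (u b : VectorField) (t : ℝ) : ℝ≥0∞ :=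
  (⨆ τ ∈ Icc 0 t, ((∑ k, h2Sq (u k τ)) + ∑ k, h2Sq (b k τ))) +
    ∫⁻ τ in Icc 0 t, ∑ i, ∑ k, h2Sq (pd i (u k τ))

/-- `E₁(t) = ∫₀ᵗ ‖∂₂ b(τ)‖²_{H¹} dτ`. -/
def E₁ (b : VectorField) (t : ℝ) : ℝ≥0∞ :=
  ∫⁻ τ in Icc 0 t, ∑ k, h1Sq (pd 1 (b k τ))

/-- `Ω₊ = u₁ + b₁`. -/
def omegaPlus (u b : VectorField) : ScalarField := fun τ x => u 0 τ x + b 0 τ x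

/-- `Ω₋ = u₁ - b₁`. -/
def omegaMinus (u b : VectorField) : ScalarField := fun τ x => u 0 τ x - b 0 τ x

/-- `A₊(t) = ∫₀ᵗ ∫ |Ω₊|² |∂₁² b₂|² dx dτ`. -/
def APlus (u b : VectorField) (t : ℝ) : ℝ≥0∞ :=
  ∫⁻ τ in Icc 0 t, ∫⁻ x, ‖omegaPlus u b τ x‖ₑ ^ 2 * ‖pd 0 (pd 0 (b 1 τ)) x‖ₑ ^ 2

/-- `A₋(t) = ∫₀ᵗ ∫ |Ω₋|² |∂₁² b₂|² dx dτ`. -/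
def AMinus (u b : VectorField) (t : ℝ) : ℝ≥0∞ :=
  ∫⁻ τ in Icc 0 t, ∫⁻ x, ‖omegaMinus u b τ x‖ₑ ^ 2 * ‖pd 0 (pd 0 (b 1 τ)) x‖ₑ ^ 2

/-- `(u, b, P)` is a smooth finite-energy solution on `[0, T] × ℝ²` of the viscous, non-resistive
incompressible MHD equations, perturbed around the constant magnetic field `(0, 1)`:
`∂ₜu + u·∇u - Δu + ∇P = b·∇b + ∂₂b`, `∂ₜb + u·∇b = b·∇u + ∂₂u`, `div u = div b = 0`.
Three continuous derivatives up to the boundary in time are enough smoothness. -/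
structure IsSmoothSolution (T : ℝ) (u b : VectorField) (P : ScalarField) : Prop where
  u_smooth : ∀ k, ContDiffOn ℝ 3 (fun p : ℝ × Plane => u k p.1 p.2) (Icc 0 T ×ˢ univ)
  b_smooth : ∀ k, ContDiffOn ℝ 3 (fun p : ℝ × Plane => b k p.1 p.2) (Icc 0 T ×ˢ univ)
  P_smooth : ∀ τ ∈ Ioo 0 T, ContDiff ℝ 1 (P τ)
  momentum : ∀ k, ∀ τ ∈ Ioo 0 T, ∀ x,
    deriv (fun s => u k s x) τ + advect (fun j => u j τ) (u k τ) x
        - laplacian (u k τ) x + pd k (P τ) x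
      = advect (fun j => b j τ) (b k τ) x + pd 1 (b k τ) x
  induction : ∀ k, ∀ τ ∈ Ioo 0 T, ∀ x,
    deriv (fun s => b k s x) τ + advect (fun j => u j τ) (b k τ) x
      = advect (fun j => b j τ) (u k τ) x + pd 1 (u k τ) x
  div_u : ∀ τ ∈ Icc 0 T, ∀ x, ∑ i, pd i (u i τ) x = 0
  div_b : ∀ τ ∈ Icc 0 T, ∀ x, ∑ i, pd i (b i τ) x = 0
  /-- `u, b ∈ L^∞(0, T; H²)` and `∇u ∈ L²(0, T; H²)`. -/
  finite_energy : E₀ u b T < ∞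

end MHD

end

/-!
The integral of `∂₂u₂ w²`, with `w = ∂₁²b₂`, is estimated through the transport equations along
the flow of `u`. Write `D = ∂ₜ + u·∇`. The induction equation says `∂₂u₂ = D b₂ - b·∇u₂`, and
differentiating it gives `D w = 3 ∂₂u₂ w + G` with `G` free of `∂₂u₂ w` (`pd_pd_inductionRHS`).
Hence `D (b₂ w²)` produces `∂₂u₂ w²`, up to terms that are small, and up to multiples of `b₂ ∂₂u₂
w²`, which cannot be bounded directly: `w` is only bounded in time with values in `L²`, while
`∂₂u₂` is square integrable and `b₂` merely fourth-power integrable in time. The corrector `-(7/2)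
b₂² w²` removes exactly this term. So the proof rests on one exact balance law for the density
`(b₂ - (7/2) b₂²) w²` (`density_balance`). The linear contribution `b₂ w ∂₂∂₁²u₂` of `G` is first
written as a divergence plus terms in which a factor `∂₂b₂` or `∂₁∂₂b₂` appears.

The values of the density at the two endpoint times are bounded by the energy alone
(`lintegral_density_le`). The terms under the time integral are of two kinds. The term `b₁ ∂₁u₂
w²` is handled by the Cauchy-Schwarz inequality in space-time and `2 b₁ = Ω₊ - Ω₋`
(`lintegral_b₁_term_le`). Every other term is bounded at almost every time by a constant multiple
of `(e + e² + e³) ‖∂₂b‖_{H¹} ‖∇u‖_{H²}` with `e² = E₀` (`FixedTimeBounds.lintegral_remainder_le`),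
and both norms are square integrable in time. These bounds come from two anisotropic inequalities,
`enorm_sq_le_of_l2` and `l2Sq_mul_le`: the first gives `‖b‖_∞² ≲ e ‖∂₂b‖_{H¹}`, so that two
undifferentiated magnetic factors are worth one factor `‖∂₂b‖_{H¹}`.

The balance law is only known pointwise, and the third derivatives of `b` need not be integrable.
`integral_balance` shows that a pointwise space-time balance law with integrable flux and source
holds globally; its proof applies the divergence theorem on boxes with a polynomial cutoff that
vanishes on the lateral boundary.
-/

namespace MHD

open Filter Topology

/-! ### Anisotropic inequalities in the plane -/

theorem lintegral_enorm_mul_le {α : Type*} [MeasurableSpace α] (μ : Measure α) {f g : α → ℝ}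
    (hf : AEMeasurable f μ) (hg : AEMeasurable g μ) :
    ∫⁻ x, ‖f x‖ₑ * ‖g x‖ₑ ∂μ
      ≤ (∫⁻ x, ‖f x‖ₑ ^ 2 ∂μ) ^ (1 / 2 : ℝ) * (∫⁻ x, ‖g x‖ₑ ^ 2 ∂μ) ^ (1 / 2 : ℝ) := by
  have h := ENNReal.lintegral_mul_le_Lp_mul_Lq μ Real.HolderConjugate.two_two hf.enorm hg.enorm
  simpa [ENNReal.rpow_two] using h

/-- For a continuously differentiable function on the line which is square integrable,
`|g y|² ≤ 2 ∫ |g| |g'|`. -/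
theorem enorm_sq_le_lintegral_mul_deriv {g g' : ℝ → ℝ} (hg : ∀ y, HasDerivAt g (g' y) y)
    (hg' : Continuous g') (h2 : ∫⁻ y, ‖g y‖ₑ ^ 2 < ∞) (y : ℝ) :
    ‖g y‖ₑ ^ 2 ≤ 2 * ∫⁻ z, ‖g z‖ₑ * ‖g' z‖ₑ := by
  have hgc : Continuous g := continuous_iff_continuousAt.2 fun y => (hg y).continuousAt
  rcases eq_or_ne (∫⁻ z, ‖g z‖ₑ * ‖g' z‖ₑ) ∞ with h | h
  · simp [h]
  have hint : Integrable (fun z => g z * g' z) := by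
    refine ⟨(hgc.mul hg').aestronglyMeasurable, ?_⟩
    simpa [HasFiniteIntegral, enorm_mul] using h.lt_top
  have hint2 : Integrable (fun z => g z ^ 2) := by
    refine ⟨(hgc.pow 2).aestronglyMeasurable, ?_⟩
    simpa [HasFiniteIntegral, enorm_pow] using h2
  have hd : ∀ z, HasDerivAt (fun z => g z ^ 2) (2 * (g z * g' z)) z := fun z => by
    simpa [mul_assoc] using (hg z).fun_pow 2
  have hlim : Tendsto (fun z => g z ^ 2) atTop (𝓝 0) :=
    tendsto_zero_of_hasDerivAt_of_integrableOn_Ioi (a := y) (fun z _ => hd z)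
      (hint.const_mul 2).integrableOn hint2.integrableOn
  have key := integral_Ioi_of_hasDerivAt_of_tendsto' (a := y) (fun z _ => hd z)
    (hint.const_mul 2).integrableOn hlim
  have : ‖g y‖ₑ ^ 2 = ‖∫ z in Ioi y, 2 * (g z * g' z)‖ₑ := by
    rw [key, zero_sub, enorm_neg, enorm_pow]
  rw [this]
  calc ‖∫ z in Ioi y, 2 * (g z * g' z)‖ₑ ≤ ∫⁻ z in Ioi y, ‖2 * (g z * g' z)‖ₑ :=
        enorm_integral_le_lintegral_enorm _
    _ ≤ ∫⁻ z, ‖2 * (g z * g' z)‖ₑ := setLIntegral_le_lintegral _ _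
    _ = 2 * ∫⁻ z, ‖g z‖ₑ * ‖g' z‖ₑ := by
        rw [← lintegral_const_mul' _ _ (by simp)]
        refine lintegral_congr fun z => ?_
        rw [enorm_mul, enorm_mul]
        congr 1
        simp [Real.enorm_eq_ofReal]

/-- The `L²` norm on the plane, as an extended nonnegative number. -/
noncomputable def l2 (f : Plane → ℝ) : ℝ≥0∞ := l2Sq f ^ (1 / 2 : ℝ)

theorem l2_sq (f : Plane → ℝ) : l2 f ^ 2 = l2Sq f := by
  rw [l2, ← ENNReal.rpow_two, ← ENNReal.rpow_mul]; simp

theorem lintegral_mul_le_l2 {f g : Plane → ℝ} (hf : Continuous f) (hg : Continuous g) :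
    ∫⁻ x, ‖f x‖ₑ * ‖g x‖ₑ ≤ l2 f * l2 g :=
  lintegral_enorm_mul_le _ hf.measurable.aemeasurable hg.measurable.aemeasurable

theorem l2_le_of_sq_le {f : Plane → ℝ} {c : ℝ≥0∞} (h : l2Sq f ≤ c ^ 2) : l2 f ≤ c := by
  rw [← l2_sq] at h
  exact (ENNReal.pow_le_pow_left_iff two_ne_zero).1 h

theorem l2_mul_le_of_bound {f g : Plane → ℝ} {c : ℝ≥0∞} (hc : c ≠ ∞) (hf : ∀ x, ‖f x‖ₑ ≤ c) :
    l2 (fun x => f x * g x) ≤ c * l2 g := by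
  refine l2_le_of_sq_le ?_
  rw [mul_pow, l2_sq, l2Sq, l2Sq, ← lintegral_const_mul' _ _ (by finiteness)]
  refine lintegral_mono fun x => ?_
  rw [enorm_mul, mul_pow]
  gcongr
  exact hf x

theorem hasDerivAt_slice_fst {f : Plane → ℝ} (hf : ContDiff ℝ 1 f) (x y : ℝ) :
    HasDerivAt (fun s => f (s, y)) (pd 0 f (x, y)) x := by
  have h1 : HasFDerivAt f (fderiv ℝ f (x, y)) (x, y) :=
    (hf.differentiable one_ne_zero (x, y)).hasFDerivAt
  have h2 : HasDerivAt (fun s : ℝ => (s, y)) ((1 : ℝ), (0 : ℝ)) x :=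
    (hasDerivAt_id x).prodMk (hasDerivAt_const x y)
  exact h1.comp_hasDerivAt x h2

theorem hasDerivAt_slice_snd {f : Plane → ℝ} (hf : ContDiff ℝ 1 f) (x y : ℝ) :
    HasDerivAt (fun s => f (x, s)) (pd 1 f (x, y)) y := by
  have h1 : HasFDerivAt f (fderiv ℝ f (x, y)) (x, y) :=
    (hf.differentiable one_ne_zero (x, y)).hasFDerivAt
  have h2 : HasDerivAt (fun s : ℝ => (x, s)) ((0 : ℝ), (1 : ℝ)) y :=
    (hasDerivAt_const y x).prodMk (hasDerivAt_id y)
  exact h1.comp_hasDerivAt y h2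

theorem contDiff_pd {f : Plane → ℝ} {n : ℕ} (hf : ContDiff ℝ (n + 1 : ℕ) f) (i : Fin 2) :
    ContDiff ℝ n (pd i f) :=
  (hf.fderiv_right (m := n) (by norm_cast)).clm_apply contDiff_const

theorem continuous_pd {f : Plane → ℝ} (hf : ContDiff ℝ 1 f) (i : Fin 2) : Continuous (pd i f) :=
  (hf.continuous_fderiv one_ne_zero).clm_apply continuous_const

theorem lintegral_plane {f : Plane → ℝ≥0∞} (hf : Measurable f) :
    ∫⁻ z, f z = ∫⁻ x, ∫⁻ y, f (x, y) := by
  rw [Measure.volume_eq_prod, lintegral_prod _ hf.aemeasurable]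

theorem lintegral_plane_swap {f : Plane → ℝ≥0∞} (hf : Measurable f) :
    ∫⁻ z, f z = ∫⁻ y, ∫⁻ x, f (x, y) := by
  rw [Measure.volume_eq_prod, lintegral_prod_symm _ hf.aemeasurable]

/-- On almost every vertical line a square integrable function is controlled by the integral of
`2 |f| |∂₂ f|` over that line. -/
theorem ae_enorm_sq_le_snd {f : Plane → ℝ} (hf : ContDiff ℝ 1 f) (h2 : l2 f < ∞) :
    ∀ᵐ x : ℝ, ∀ y : ℝ, ‖f (x, y)‖ₑ ^ 2 ≤ 2 * ∫⁻ z, ‖f (x, z)‖ₑ * ‖pd 1 f (x, z)‖ₑ := by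
  have hm : Measurable fun z => ‖f z‖ₑ ^ 2 := (hf.continuous.measurable.enorm).pow_const 2
  have h : ∫⁻ x, ∫⁻ y, ‖f (x, y)‖ₑ ^ 2 ≠ ∞ := by
    rw [← lintegral_plane hm, ← l2Sq, ← l2_sq]; finiteness
  filter_upwards [ae_lt_top hm.lintegral_prod_right' h] with x hx y
  exact enorm_sq_le_lintegral_mul_deriv (g := fun s => f (x, s)) (g' := fun s => pd 1 f (x, s))
    (fun y => hasDerivAt_slice_snd hf x y) ((continuous_pd hf 1).comp (by fun_prop)) hx y

theorem ae_enorm_sq_le_fst {f : Plane → ℝ} (hf : ContDiff ℝ 1 f) (h2 : l2 f < ∞) :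
    ∀ᵐ y : ℝ, ∀ x : ℝ, ‖f (x, y)‖ₑ ^ 2 ≤ 2 * ∫⁻ z, ‖f (z, y)‖ₑ * ‖pd 0 f (z, y)‖ₑ := by
  have hm : Measurable fun z => ‖f z‖ₑ ^ 2 := (hf.continuous.measurable.enorm).pow_const 2
  have h : ∫⁻ y, ∫⁻ x, ‖f (x, y)‖ₑ ^ 2 ≠ ∞ := by
    rw [← lintegral_plane_swap hm, ← l2Sq, ← l2_sq]; finiteness
  filter_upwards [ae_lt_top hm.lintegral_prod_left' h] with y hy x
  exact enorm_sq_le_lintegral_mul_deriv (g := fun s => f (s, y)) (g' := fun s => pd 0 f (s, y))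
    (fun x => hasDerivAt_slice_fst hf x y) ((continuous_pd hf 0).comp (by fun_prop)) hy x

theorem measurable_enorm_mul_pd {f : Plane → ℝ} (hf : ContDiff ℝ 1 f) (i : Fin 2) :
    Measurable fun z => ‖f z‖ₑ * ‖pd i f z‖ₑ :=
  hf.continuous.measurable.enorm.mul (continuous_pd hf i).measurable.enorm

theorem lintegral_slice_fst_le {f : Plane → ℝ} (hf : ContDiff ℝ 1 f) (h2 : l2 f < ∞) (y : ℝ) :
    ∫⁻ x, ‖f (x, y)‖ₑ ^ 2 ≤ 2 * (l2 f * l2 (pd 1 f)) := by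
  calc ∫⁻ x, ‖f (x, y)‖ₑ ^ 2 ≤ ∫⁻ x, 2 * ∫⁻ z, ‖f (x, z)‖ₑ * ‖pd 1 f (x, z)‖ₑ :=
        lintegral_mono_ae ((ae_enorm_sq_le_snd hf h2).mono fun x hx => hx y)
    _ = 2 * ∫⁻ z, ‖f z‖ₑ * ‖pd 1 f z‖ₑ := by
        rw [lintegral_const_mul' _ _ (by simp), lintegral_plane (measurable_enorm_mul_pd hf 1)]
    _ ≤ _ := by gcongr; exact lintegral_mul_le_l2 hf.continuous (continuous_pd hf 1)

theorem lintegral_slice_snd_le {f : Plane → ℝ} (hf : ContDiff ℝ 1 f) (h2 : l2 f < ∞) (x : ℝ) :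
    ∫⁻ y, ‖f (x, y)‖ₑ ^ 2 ≤ 2 * (l2 f * l2 (pd 0 f)) := by
  calc ∫⁻ y, ‖f (x, y)‖ₑ ^ 2 ≤ ∫⁻ y, 2 * ∫⁻ z, ‖f (z, y)‖ₑ * ‖pd 0 f (z, y)‖ₑ :=
        lintegral_mono_ae ((ae_enorm_sq_le_fst hf h2).mono fun y hy => hy x)
    _ = 2 * ∫⁻ z, ‖f z‖ₑ * ‖pd 0 f z‖ₑ := by
        rw [lintegral_const_mul' _ _ (by simp),
          lintegral_plane_swap (measurable_enorm_mul_pd hf 0)]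
    _ ≤ _ := by gcongr; exact lintegral_mul_le_l2 hf.continuous (continuous_pd hf 0)

/-- Anisotropic product estimate
`‖f g‖_{L²}² ≤ 4 ‖f‖_{L²} ‖∂₂ f‖_{L²} ‖g‖_{L²} ‖∂₁ g‖_{L²}`: `f` is placed in
`L^∞_{x₂} L²_{x₁}` and `g` in `L²_{x₂} L^∞_{x₁}`. -/
theorem l2Sq_mul_le {f g : Plane → ℝ} (hf : ContDiff ℝ 1 f) (hg : ContDiff ℝ 1 g)
    (hf2 : l2 f < ∞) (hg2 : l2 g < ∞) :
    l2Sq (fun x => f x * g x) ≤ 4 * ((l2 f * l2 (pd 1 f)) * (l2 g * l2 (pd 0 g))) := by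
  have hm : Measurable fun z => ‖f z * g z‖ₑ ^ 2 :=
    ((hf.continuous.mul hg.continuous).measurable.enorm).pow_const 2
  have hmf : Measurable fun z => ‖f z‖ₑ ^ 2 := (hf.continuous.measurable.enorm).pow_const 2
  have hmg := measurable_enorm_mul_pd hg 0
  calc l2Sq (fun x => f x * g x) = ∫⁻ y, ∫⁻ x, ‖f (x, y) * g (x, y)‖ₑ ^ 2 := by
        rw [l2Sq, lintegral_plane_swap hm]
    _ ≤ ∫⁻ y, (2 * (l2 f * l2 (pd 1 f))) * (2 * ∫⁻ z, ‖g (z, y)‖ₑ * ‖pd 0 g (z, y)‖ₑ) := by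
        refine lintegral_mono_ae ((ae_enorm_sq_le_fst hg hg2).mono fun y hy => ?_)
        calc ∫⁻ x, ‖f (x, y) * g (x, y)‖ₑ ^ 2
            ≤ ∫⁻ x, ‖f (x, y)‖ₑ ^ 2 * (2 * ∫⁻ z, ‖g (z, y)‖ₑ * ‖pd 0 g (z, y)‖ₑ) := by
              refine lintegral_mono fun x => ?_
              rw [enorm_mul, mul_pow]
              gcongr
              exact hy x
          _ = (∫⁻ x, ‖f (x, y)‖ₑ ^ 2) * (2 * ∫⁻ z, ‖g (z, y)‖ₑ * ‖pd 0 g (z, y)‖ₑ) :=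
              lintegral_mul_const _ (hmf.comp (by fun_prop))
          _ ≤ _ := by gcongr; exact lintegral_slice_fst_le hf hf2 y
    _ = (2 * (l2 f * l2 (pd 1 f))) * (2 * ∫⁻ z, ‖g z‖ₑ * ‖pd 0 g z‖ₑ) := by
        rw [lintegral_const_mul _ (hmg.lintegral_prod_left'.const_mul _),
          lintegral_const_mul' _ _ (by simp), lintegral_plane_swap hmg]
    _ ≤ (2 * (l2 f * l2 (pd 1 f))) * (2 * (l2 g * l2 (pd 0 g))) := by
        gcongr; exact lintegral_mul_le_l2 hg.continuous (continuous_pd hg 0)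
    _ = _ := by ring

/-- Anisotropic Agmon inequality: `‖f‖_∞² ≤ 4 a c` when `‖f‖, ‖∂₁ f‖ ≤ a` and
`‖∂₂ f‖, ‖∂₁ ∂₂ f‖ ≤ c` in `L²`. -/
theorem enorm_sq_le_of_l2 {f : Plane → ℝ} (hf : ContDiff ℝ 2 f) {a c : ℝ≥0∞} (ha : a < ∞)
    (hc : c < ∞) (h0 : l2 f ≤ a) (h1 : l2 (pd 0 f) ≤ a) (h2 : l2 (pd 1 f) ≤ c)
    (h12 : l2 (pd 0 (pd 1 f)) ≤ c) (z : Plane) : ‖f z‖ₑ ^ 2 ≤ 4 * (a * c) := by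
  have hf1 : ContDiff ℝ 1 f := hf.of_le (by norm_num)
  have hpf : ContDiff ℝ 1 (pd 1 f) := contDiff_pd (n := 1) hf 1
  have hsq : ∀ d : ℝ≥0∞, (2 * (d * d)) ^ (1 / 2 : ℝ) = 2 ^ (1 / 2 : ℝ) * d := fun d => by
    rw [ENNReal.mul_rpow_of_nonneg _ _ (by norm_num), ← sq, ← ENNReal.rpow_two,
      ← ENNReal.rpow_mul]; simp
  have hae : ∀ᵐ x : ℝ, ∀ y : ℝ, ‖f (x, y)‖ₑ ^ 2 ≤ 4 * (a * c) := by
    filter_upwards [ae_enorm_sq_le_snd hf1 (h0.trans_lt ha)] with x hx y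
    refine (hx y).trans ?_
    calc 2 * ∫⁻ z, ‖f (x, z)‖ₑ * ‖pd 1 f (x, z)‖ₑ
        ≤ 2 * ((∫⁻ z, ‖f (x, z)‖ₑ ^ 2) ^ (1 / 2 : ℝ)
            * (∫⁻ z, ‖pd 1 f (x, z)‖ₑ ^ 2) ^ (1 / 2 : ℝ)) := by
          gcongr
          exact lintegral_enorm_mul_le _ (hf.continuous.comp (by fun_prop)).measurable.aemeasurable
            (hpf.continuous.comp (by fun_prop)).measurable.aemeasurable
      _ ≤ 2 * ((2 * (a * a)) ^ (1 / 2 : ℝ) * (2 * (c * c)) ^ (1 / 2 : ℝ)) := by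
          gcongr
          · exact (lintegral_slice_snd_le hf1 (h0.trans_lt ha) x).trans (by gcongr)
          · exact (lintegral_slice_snd_le hpf (h2.trans_lt hc) x).trans (by gcongr)
      _ = 2 * ((2 ^ (1 / 2 : ℝ) * 2 ^ (1 / 2 : ℝ)) * (a * c)) := by
          rw [hsq, hsq]; ring
      _ = 4 * (a * c) := by
          rw [← ENNReal.rpow_add _ _ (by simp) (by simp)]
          norm_num
          rw [← mul_assoc]; norm_num
  have hd : Dense {x : ℝ | ∀ y : ℝ, ‖f (x, y)‖ₑ ^ 2 ≤ 4 * (a * c)} :=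
    Measure.dense_of_ae hae
  -- The estimate extends from almost every vertical line to all of them by continuity.
  have hcl : IsClosed {x : ℝ | ‖f (x, z.2)‖ₑ ^ 2 ≤ 4 * (a * c)} :=
    isClosed_le (by have := hf.continuous; fun_prop) continuous_const
  have hsub := hcl.closure_subset_iff.2
    (fun x (hx : x ∈ {x : ℝ | ∀ y : ℝ, ‖f (x, y)‖ₑ ^ 2 ≤ 4 * (a * c)}) => hx z.2)
  exact hsub (hd z.1)

/-! ### Space-time regularity -/

/-- The closed space-time slab `[0, t] × ℝ²`. -/
def slab (t : ℝ) : Set (ℝ × Plane) := Icc 0 t ×ˢ univ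

/-- The function of space and time underlying a time-dependent scalar function. -/
def joint (g : ScalarField) : ℝ × Plane → ℝ := fun p => g p.1 p.2

/-- The spatial partial derivative of a time-dependent scalar function. -/
noncomputable def spd (i : Fin 2) (g : ScalarField) : ScalarField := fun τ => pd i (g τ)

theorem uniqueDiffOn_slab {T : ℝ} (hT : 0 < T) : UniqueDiffOn ℝ (slab T) :=
  (uniqueDiffOn_Icc hT).prod uniqueDiffOn_univ

theorem hasFDerivAt_space (τ : ℝ) (x : Plane) :
    HasFDerivAt (fun y : Plane => (τ, y)) (ContinuousLinearMap.inr ℝ ℝ Plane) x :=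
  hasFDerivAt_prodMk_right τ x

theorem contDiff_slice {T : ℝ} {g : ScalarField} {n : WithTop ℕ∞}
    (hg : ContDiffOn ℝ n (joint g) (slab T)) {τ : ℝ} (hτ : τ ∈ Icc 0 T) : ContDiff ℝ n (g τ) := by
  rw [← contDiffOn_univ]
  exact hg.comp (f := fun y : Plane => (τ, y)) (contDiff_const.prodMk contDiff_id).contDiffOn
    fun y _ => ⟨hτ, mem_univ _⟩

theorem pd_eq_fderivWithin {T : ℝ} {g : ScalarField}
    (hg : DifferentiableOn ℝ (joint g) (slab T)) {τ : ℝ} (hτ : τ ∈ Icc 0 T)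
    (i : Fin 2) (x : Plane) :
    pd i (g τ) x = fderivWithin ℝ (joint g) (slab T) (τ, x) (0, e i) := by
  have h1 := (hg (τ, x) ⟨hτ, mem_univ _⟩).hasFDerivWithinAt
  have h2 : HasFDerivWithinAt (fun y : Plane => (τ, y)) (ContinuousLinearMap.inr ℝ ℝ Plane)
      univ x := (hasFDerivAt_space τ x).hasFDerivWithinAt
  have h3 : HasFDerivAt (g τ) _ x :=
    hasFDerivWithinAt_univ.1 (h1.comp x h2 fun y _ => ⟨hτ, mem_univ _⟩)
  rw [pd, h3.fderiv]
  simp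

theorem contDiffOn_spd {T : ℝ} (hT : 0 < T) {g : ScalarField} {n : ℕ}
    (hg : ContDiffOn ℝ (n + 1 : ℕ) (joint g) (slab T)) (i : Fin 2) :
    ContDiffOn ℝ n (joint (spd i g)) (slab T) := by
  have h1 : ContDiffOn ℝ n (fun p => fderivWithin ℝ (joint g) (slab T) p (0, e i)) (slab T) :=
    (hg.fderivWithin (uniqueDiffOn_slab hT) (by norm_cast)).clm_apply contDiffOn_const
  refine h1.congr fun p hp => ?_
  exact pd_eq_fderivWithin (hg.differentiableOn (by norm_cast)) hp.1 i p.2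

theorem slab_mem_nhds {T τ : ℝ} (hτ : τ ∈ Ioo 0 T) (x : Plane) : slab T ∈ 𝓝 (τ, x) :=
  prod_mem_nhds (Icc_mem_nhds hτ.1 hτ.2) univ_mem

theorem differentiableAt_joint {T : ℝ} {g : ScalarField}
    (hg : ContDiffOn ℝ 1 (joint g) (slab T)) {τ : ℝ} (hτ : τ ∈ Ioo 0 T) (x : Plane) :
    DifferentiableAt ℝ (joint g) (τ, x) :=
  (hg.contDiffAt (slab_mem_nhds hτ x)).differentiableAt one_ne_zero

theorem pd_eq_fderiv {g : ScalarField} {τ : ℝ} {x : Plane}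
    (hg : DifferentiableAt ℝ (joint g) (τ, x)) (i : Fin 2) :
    pd i (g τ) x = fderiv ℝ (joint g) (τ, x) (0, e i) := by
  have h3 : HasFDerivAt (g τ) _ x := hg.hasFDerivAt.comp x (hasFDerivAt_space τ x)
  rw [pd, h3.fderiv]
  simp

theorem hasDerivAt_time {g : ScalarField} {τ : ℝ} {x : Plane}
    (hg : DifferentiableAt ℝ (joint g) (τ, x)) :
    HasDerivAt (fun s => g s x) (fderiv ℝ (joint g) (τ, x) (1, 0)) τ :=
  HasFDerivAt.comp_hasDerivAt (f := fun s => (s, x)) τ hg.hasFDerivAt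
    ((hasDerivAt_id τ).prodMk (hasDerivAt_const τ x))

theorem deriv_spd {T : ℝ} {g : ScalarField} (hg : ContDiffOn ℝ 2 (joint g) (slab T))
    {τ : ℝ} (hτ : τ ∈ Ioo 0 T) (i : Fin 2) (x : Plane) :
    deriv (fun s => spd i g s x) τ = pd i (fun y => deriv (fun s => g s y) τ) x := by
  have hg1 : ContDiffOn ℝ 1 (joint g) (slab T) := hg.of_le (by norm_num)
  have hc : ContDiffAt ℝ 2 (joint g) (τ, x) := hg.contDiffAt (slab_mem_nhds hτ x)
  have hsymm := hc.isSymmSndFDerivAt (by simp)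
  have hd : DifferentiableAt ℝ (fderiv ℝ (joint g)) (τ, x) :=
    (hc.fderiv_right (m := 1) (by norm_num)).differentiableAt one_ne_zero
  have ht : HasDerivAt (fun s => fderiv ℝ (joint g) (s, x) (0, e i))
      (fderiv ℝ (fderiv ℝ (joint g)) (τ, x) (1, 0) (0, e i)) τ := by
    have := hd.hasFDerivAt.comp_hasDerivAt τ ((hasDerivAt_id τ).prodMk (hasDerivAt_const τ x))
    simpa using this.clm_apply (hasDerivAt_const τ ((0 : ℝ), e i))
  have hs : HasFDerivAt (fun y => fderiv ℝ (joint g) (τ, y) ((1 : ℝ), (0 : Plane)))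
      (((fderiv ℝ (fderiv ℝ (joint g)) (τ, x)).comp
        (ContinuousLinearMap.inr ℝ ℝ Plane)).flip (1, 0)) x := by
    have := hd.hasFDerivAt.comp x (hasFDerivAt_space τ x)
    have h2 := this.clm_apply (hasFDerivAt_const ((1 : ℝ), (0 : Plane)) x)
    simpa using h2
  have hl : (fun s => spd i g s x) =ᶠ[𝓝 τ] fun s => fderiv ℝ (joint g) (s, x) (0, e i) := by
    filter_upwards [Ioo_mem_nhds hτ.1 hτ.2] with s hs
    exact pd_eq_fderiv (differentiableAt_joint hg1 hs x) i
  have hr : (fun y => deriv (fun s => g s y) τ)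
      = fun y => fderiv ℝ (joint g) (τ, y) ((1 : ℝ), (0 : Plane)) := by
    funext y
    exact (hasDerivAt_time (differentiableAt_joint hg1 hτ y)).deriv
  rw [hl.deriv_eq, ht.deriv, hr, pd, hs.fderiv]
  simpa using hsymm (1, 0) (0, e i)

theorem pd_comm {f : Plane → ℝ} (hf : ContDiff ℝ 2 f) (i j : Fin 2) :
    pd i (pd j f) = pd j (pd i f) := by
  funext x
  have hsymm := hf.contDiffAt.isSymmSndFDerivAt (x := x) (by simp)
  have hd : DifferentiableAt ℝ (fderiv ℝ f) x :=
    (hf.fderiv_right (m := 1) (by norm_num)).differentiable one_ne_zero x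
  have key : ∀ i j : Fin 2, pd i (pd j f) x = fderiv ℝ (fderiv ℝ f) x (e i) (e j) := fun i j => by
    have h : HasFDerivAt (pd j f) _ x := hd.hasFDerivAt.clm_apply (hasFDerivAt_const (e j) x)
    rw [pd, h.fderiv]
    simp
  rw [key, key, hsymm.eq]

/-! ### The divergence theorem on a space-time box -/

/-- Space-time `ℝ × ℝ²` as `Fin 3 → ℝ`. -/
noncomputable def spaceTimeEquiv : (ℝ × Plane) ≃L[ℝ] (Fin 3 → ℝ) :=
  LinearEquiv.toContinuousLinearEquiv
    { toFun := fun p => ![p.1, p.2.1, p.2.2]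
      invFun := fun v => (v 0, v 1, v 2)
      left_inv := fun _ => rfl
      right_inv := fun v => by ext i; fin_cases i <;> rfl
      map_add' := fun p q => by ext i; fin_cases i <;> rfl
      map_smul' := fun c p => by ext i; fin_cases i <;> rfl }

theorem measurePreserving_spaceTimeEquiv :
    MeasurePreserving spaceTimeEquiv volume volume := by
  have h1 := (volume_preserving_piFinSuccAbove (fun _ : Fin 3 => ℝ) 0).symm
  have h2 := (MeasurePreserving.id (volume : Measure ℝ)).prod
    (volume_preserving_finTwoArrow ℝ).symm
  have h3 := h1.comp h2
  have heq : ⇑spaceTimeEquiv = (MeasurableEquiv.piFinSuccAbove (fun _ : Fin 3 => ℝ) 0).symm ∘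
      Prod.map id MeasurableEquiv.finTwoArrow.symm := by
    funext p
    ext i
    fin_cases i <;> rfl
  rw [heq]
  exact h3

/-- Divergence theorem on `[0, t] × [-R, R]²` for a field whose spatial components vanish on the
lateral faces. Differentiability is only needed in the open box. -/
theorem integral_divergence_box (f : Fin 3 → ℝ × Plane → ℝ) {t R : ℝ} (ht : 0 ≤ t) (hR : 0 ≤ R)
    (hc : ∀ i, ContinuousOn (f i) (Icc 0 t ×ˢ Icc (-R, -R) (R, R)))
    (hd : ∀ p ∈ Ioo 0 t ×ˢ (Ioo (-R) R ×ˢ Ioo (-R) R), ∀ i, DifferentiableAt ℝ (f i) p)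
    (h1 : ∀ p : ℝ × Plane, p.2.1 = R ∨ p.2.1 = -R → f 1 p = 0)
    (h2 : ∀ p : ℝ × Plane, p.2.2 = R ∨ p.2.2 = -R → f 2 p = 0)
    (hi : IntegrableOn (fun p => fderiv ℝ (f 0) p (1, 0) + fderiv ℝ (f 1) p (0, e 0)
      + fderiv ℝ (f 2) p (0, e 1)) (Icc 0 t ×ˢ Icc (-R, -R) (R, R))) :
    ∫ p in Icc 0 t ×ˢ Icc (-R, -R) (R, R), (fderiv ℝ (f 0) p (1, 0) + fderiv ℝ (f 1) p (0, e 0)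
      + fderiv ℝ (f 2) p (0, e 1))
    = (∫ x in Icc (-R, -R) (R, R), f 0 (t, x)) - ∫ x in Icc (-R, -R) (R, R), f 0 (0, x) := by
  have hbox : Icc ((0 : ℝ), (-R, -R)) (t, (R, R)) = Icc 0 t ×ˢ Icc (-R, -R) (R, R) :=
    (Icc_prod_eq _ _)
  have hint : interior (Icc ((0 : ℝ), (-R, -R)) (t, (R, R)))
      = Ioo 0 t ×ˢ (Ioo (-R) R ×ˢ Ioo (-R) R) := by
    rw [hbox, interior_prod_eq, Icc_prod_eq, interior_prod_eq]; simp
  have key := integral_divergence_of_hasFDerivAt_off_countable_of_equiv (E := ℝ) spaceTimeEquiv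
    (fun p q => ?_) measurePreserving_spaceTimeEquiv f (fun i p => fderiv ℝ (f i) p) ∅
    countable_empty ((0 : ℝ), ((-R, -R) : Plane)) (t, (R, R))
    (Prod.mk_le_mk.2 ⟨ht, Prod.mk_le_mk.2 ⟨by linarith, by linarith⟩⟩) (by rwa [hbox])
    (fun p hp i => (hd p (by rw [hint] at hp; exact hp.1) i).hasFDerivAt)
    (fun p => fderiv ℝ (f 0) p (1, 0) + fderiv ℝ (f 1) p (0, e 0)
      + fderiv ℝ (f 2) p (0, e 1)) (fun p => ?_) (by rwa [hbox])
  · rw [hbox] at key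
    rw [key, Fin.sum_univ_three]
    have hz1 : ∀ c : ℝ, c = R ∨ c = -R → ∀ x : Fin 2 → ℝ,
        f 1 (spaceTimeEquiv.symm (Fin.insertNth 1 c x)) = 0 := fun c hc x => by
      have h : (spaceTimeEquiv.symm (Fin.insertNth 1 c x)).2.1 = c :=
        Fin.insertNth_apply_same (α := fun _ : Fin 3 => ℝ) 1 c x
      exact h1 _ (by rwa [h])
    have hz2 : ∀ c : ℝ, c = R ∨ c = -R → ∀ x : Fin 2 → ℝ,
        f 2 (spaceTimeEquiv.symm (Fin.insertNth 2 c x)) = 0 := fun c hc x => by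
      have h : (spaceTimeEquiv.symm (Fin.insertNth 2 c x)).2.2 = c :=
        Fin.insertNth_apply_same (α := fun _ : Fin 3 => ℝ) 2 c x
      exact h2 _ (by rwa [h])
    have hf : ∀ c : ℝ, (∫ x in Icc (spaceTimeEquiv (0, (-R, -R)) ∘ Fin.succAbove 0)
        (spaceTimeEquiv (t, (R, R)) ∘ Fin.succAbove 0),
          f 0 (spaceTimeEquiv.symm (Fin.insertNth 0 c x)))
        = ∫ x in Icc (-R, -R) (R, R), f 0 (c, x) := fun c => by
      rw [← ((volume_preserving_finTwoArrow ℝ).symm _).setIntegral_preimage_emb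
        (MeasurableEquiv.measurableEmbedding _)]
      congr 1
      congr 1
      ext x
      simp only [mem_preimage, mem_Icc, Pi.le_def, Fin.forall_fin_two, Prod.le_def]
      rfl
    have e1 : (spaceTimeEquiv (t, (R, R))) 1 = R := rfl
    have e1' : (spaceTimeEquiv (0, (-R, -R))) 1 = -R := rfl
    have e2 : (spaceTimeEquiv (t, (R, R))) 2 = R := rfl
    have e2' : (spaceTimeEquiv (0, (-R, -R))) 2 = -R := rfl
    have e0 : (spaceTimeEquiv (t, (R, R))) 0 = t := rfl
    have e0' : (spaceTimeEquiv (0, (-R, -R))) 0 = 0 := rfl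
    rw [e1, e1', e2, e2', e0, e0', hf, hf]
    simp only [hz1 R (.inl rfl), hz1 (-R) (.inr rfl), hz2 R (.inl rfl), hz2 (-R) (.inr rfl)]
    simp
  · simp only [Pi.le_def, Prod.le_def]
    exact ⟨fun h => ⟨h 0, h 1, h 2⟩, fun h i => by fin_cases i <;> [exact h.1; exact h.2.1; exact h.2.2]⟩
  · rw [Fin.sum_univ_three]
    have a0 : spaceTimeEquiv.symm (Pi.single 0 1) = (1, 0) := by
      rw [ContinuousLinearEquiv.symm_apply_eq]; ext i; fin_cases i <;> rfl
    have a1 : spaceTimeEquiv.symm (Pi.single 1 1) = (0, e 0) := by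
      rw [ContinuousLinearEquiv.symm_apply_eq]; ext i; fin_cases i <;> rfl
    have a2 : spaceTimeEquiv.symm (Pi.single 2 1) = (0, e 1) := by
      rw [ContinuousLinearEquiv.symm_apply_eq]; ext i; fin_cases i <;> rfl
    rw [a0, a1, a2]

/-! ### Global balance laws -/

/-- The square `[-R, R]²`. -/
def square (R : ℝ) : Set Plane := Icc (-R, -R) (R, R)

theorem mem_square {R : ℝ} {x : Plane} : x ∈ square R ↔ |x.1| ≤ R ∧ |x.2| ≤ R := by
  simp only [square, mem_Icc, Prod.le_def, abs_le]
  tauto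

/-- The polynomial `(1 - (x₁/R)²) (1 - (x₂/R)²)`, which vanishes on the boundary of `[-R, R]²`. -/
noncomputable def bump (R : ℝ) (x : Plane) : ℝ := (1 - (x.1 / R) ^ 2) * (1 - (x.2 / R) ^ 2)

/-- `∂₁` of `bump`. -/
noncomputable def bump₁ (R : ℝ) (x : Plane) : ℝ := -(2 * x.1 / R ^ 2) * (1 - (x.2 / R) ^ 2)

/-- `∂₂` of `bump`. -/
noncomputable def bump₂ (R : ℝ) (x : Plane) : ℝ := -(2 * x.2 / R ^ 2) * (1 - (x.1 / R) ^ 2)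

theorem abs_one_sub_le {R s : ℝ} (hR : 0 < R) (hs : |s| ≤ R) : |1 - (s / R) ^ 2| ≤ 1 := by
  have h : (s / R) ^ 2 ≤ 1 := by
    rw [sq_le_one_iff_abs_le_one, abs_div, abs_of_pos hR]
    exact div_le_one_of_le₀ hs hR.le
  rw [abs_le]
  constructor <;> nlinarith [sq_nonneg (s / R)]

theorem abs_two_mul_div_le {R s : ℝ} (hR : 0 < R) (hs : |s| ≤ R) : |-(2 * s / R ^ 2)| ≤ 2 / R := by
  rw [abs_neg, abs_div, abs_mul, abs_two, abs_of_pos (by positivity : (0 : ℝ) < R ^ 2),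
    div_le_div_iff₀ (by positivity) hR]
  nlinarith

theorem abs_bump_le {R : ℝ} (hR : 0 < R) {x : Plane} (hx : x ∈ square R) : |bump R x| ≤ 1 := by
  rw [mem_square] at hx
  rw [bump, abs_mul]
  exact mul_le_one₀ (abs_one_sub_le hR hx.1) (abs_nonneg _) (abs_one_sub_le hR hx.2)

theorem abs_bump₁_le {R : ℝ} (hR : 0 < R) {x : Plane} (hx : x ∈ square R) :
    |bump₁ R x| ≤ 2 / R := by
  rw [mem_square] at hx
  rw [bump₁, abs_mul, ← mul_one (2 / R)]
  gcongr
  exacts [abs_two_mul_div_le hR hx.1, abs_one_sub_le hR hx.2]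

theorem abs_bump₂_le {R : ℝ} (hR : 0 < R) {x : Plane} (hx : x ∈ square R) :
    |bump₂ R x| ≤ 2 / R := by
  rw [mem_square] at hx
  rw [bump₂, abs_mul, ← mul_one (2 / R)]
  gcongr
  exacts [abs_two_mul_div_le hR hx.2, abs_one_sub_le hR hx.1]

/-- The differential of `bump`, seen as a function of time and space. -/
theorem hasFDerivAt_bump (R : ℝ) (p : ℝ × Plane) :
    ∃ L : ℝ × Plane →L[ℝ] ℝ, HasFDerivAt (fun p : ℝ × Plane => bump R p.2) L p ∧
      L (1, 0) = 0 ∧ L (0, e 0) = bump₁ R p.2 ∧ L (0, e 1) = bump₂ R p.2 := by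
  have h1 : HasFDerivAt (fun p : ℝ × Plane => p.2.1)
      ((ContinuousLinearMap.fst ℝ ℝ ℝ).comp (ContinuousLinearMap.snd ℝ ℝ Plane)) p :=
    ((ContinuousLinearMap.fst ℝ ℝ ℝ).comp (ContinuousLinearMap.snd ℝ ℝ Plane)).hasFDerivAt
  have h2 : HasFDerivAt (fun p : ℝ × Plane => p.2.2)
      ((ContinuousLinearMap.snd ℝ ℝ ℝ).comp (ContinuousLinearMap.snd ℝ ℝ Plane)) p :=
    ((ContinuousLinearMap.snd ℝ ℝ ℝ).comp (ContinuousLinearMap.snd ℝ ℝ Plane)).hasFDerivAt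
  have h := (((h1.mul_const R⁻¹).pow 2).const_sub 1).mul
    (((h2.mul_const R⁻¹).pow 2).const_sub 1)
  refine ⟨_, h.congr_of_eventuallyEq (Eventually.of_forall fun q => by
    simp [bump, div_eq_mul_inv]), ?_, ?_, ?_⟩
  · simp
  · simp [e, bump₁]; ring
  · simp [e, bump₂]; ring

theorem fderiv_bump_mul {R : ℝ} {f : ℝ × Plane → ℝ} {p : ℝ × Plane}
    (hf : DifferentiableAt ℝ f p) :
    let D := fderiv ℝ (fun p : ℝ × Plane => bump R p.2 * f p) p
    D (1, 0) = bump R p.2 * fderiv ℝ f p (1, 0) ∧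
    D (0, e 0) = bump R p.2 * fderiv ℝ f p (0, e 0) + bump₁ R p.2 * f p ∧
    D (0, e 1) = bump R p.2 * fderiv ℝ f p (0, e 1) + bump₂ R p.2 * f p := by
  obtain ⟨L, hL, h0, h1, h2⟩ := hasFDerivAt_bump R p
  intro D
  have hD : D = bump R p.2 • fderiv ℝ f p + f p • L := (hL.mul hf.hasFDerivAt).fderiv
  rw [hD]
  simp [h0, h1, h2, mul_comm]

theorem differentiable_bump (R : ℝ) : Differentiable ℝ fun p : ℝ × Plane => bump R p.2 :=
  fun p => (hasFDerivAt_bump R p).choose_spec.1.differentiableAt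

theorem measurableSet_square (R : ℝ) : MeasurableSet (square R) := measurableSet_Icc

theorem isCompact_square (R : ℝ) : IsCompact (square R) := isCompact_Icc

theorem integrableOn_mul_of_continuous {t R : ℝ} {g : Plane → ℝ} (hg : Continuous g)
    {f : ℝ × Plane → ℝ} (hf : IntegrableOn f (slab t)) :
    IntegrableOn (fun p : ℝ × Plane => g p.2 * f p) (Icc 0 t ×ˢ square R) :=
  (hf.mono_set (prod_mono_right (subset_univ _))).continuousOn_mul (by fun_prop)
    (isCompact_Icc.prod (isCompact_square R))

theorem continuous_bump (R : ℝ) : Continuous (bump R) := by unfold bump; fun_prop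
theorem continuous_bump₁ (R : ℝ) : Continuous (bump₁ R) := by unfold bump₁; fun_prop
theorem continuous_bump₂ (R : ℝ) : Continuous (bump₂ R) := by unfold bump₂; fun_prop

theorem measurableSet_slab (t : ℝ) : MeasurableSet (slab t) :=
  measurableSet_Icc.prod MeasurableSet.univ

section BalanceLaw

variable {t : ℝ} {f V₁ V₂ H : ℝ × Plane → ℝ}

/-- The balance law tested against the polynomial cutoff on a finite square. -/
theorem integral_bump_balance (ht : 0 ≤ t) {R : ℝ} (hR : 0 < R)
    (hf : ContinuousOn f (slab t)) (hV₁ : ContinuousOn V₁ (slab t))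
    (hV₂ : ContinuousOn V₂ (slab t))
    (hdf : ∀ p ∈ Ioo 0 t ×ˢ (univ : Set Plane), DifferentiableAt ℝ f p)
    (hdV₁ : ∀ p ∈ Ioo 0 t ×ˢ (univ : Set Plane), DifferentiableAt ℝ V₁ p)
    (hdV₂ : ∀ p ∈ Ioo 0 t ×ˢ (univ : Set Plane), DifferentiableAt ℝ V₂ p)
    (hH : ∀ p ∈ Ioo 0 t ×ˢ (univ : Set Plane),
      H p = fderiv ℝ f p (1, 0) + fderiv ℝ V₁ p (0, e 0) + fderiv ℝ V₂ p (0, e 1))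
    (hiV₁ : IntegrableOn V₁ (slab t)) (hiV₂ : IntegrableOn V₂ (slab t))
    (hiH : IntegrableOn H (slab t)) :
    ∫ p in Icc 0 t ×ˢ square R,
        (bump R p.2 * H p + bump₁ R p.2 * V₁ p + bump₂ R p.2 * V₂ p)
      = (∫ x in square R, bump R x * f (t, x)) - ∫ x in square R, bump R x * f (0, x) := by
  have hsub : Icc 0 t ×ˢ square R ⊆ slab t := prod_mono_right (subset_univ _)
  have hae : ∀ᵐ p ∂(volume.restrict (Icc 0 t ×ˢ square R)), p ∈ Ioo 0 t ×ˢ (univ : Set Plane) := by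
    have h1 : ∀ᵐ p : ℝ × Plane, p.1 ≠ 0 ∧ p.1 ≠ t :=
      (Measure.quasiMeasurePreserving_fst (μ := (volume : Measure ℝ))
        (ν := (volume : Measure Plane))).ae
        ((Measure.ae_ne volume 0).and (Measure.ae_ne volume t))
    filter_upwards [ae_restrict_of_ae h1,
      ae_restrict_mem (measurableSet_Icc.prod (measurableSet_square R))] with p hp hm
    exact ⟨⟨lt_of_le_of_ne hm.1.1 hp.1.symm, lt_of_le_of_ne hm.1.2 hp.2⟩, mem_univ _⟩
  have hb : ∀ s, |s| = R → 1 - (s / R) ^ 2 = 0 := fun s hs => by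
    rw [div_pow, ← sq_abs s, hs, div_self (by positivity), sub_self]
  have habs : ∀ s : ℝ, s = R ∨ s = -R → |s| = R := fun s hs => by
    rcases hs with rfl | rfl
    · exact abs_of_pos hR
    · rw [abs_neg, abs_of_pos hR]
  have hfd : (fun p => bump R p.2 * H p + bump₁ R p.2 * V₁ p + bump₂ R p.2 * V₂ p)
      =ᵐ[volume.restrict (Icc 0 t ×ˢ square R)]
      fun p => fderiv ℝ (fun p : ℝ × Plane => bump R p.2 * f p) p (1, 0)
        + fderiv ℝ (fun p : ℝ × Plane => bump R p.2 * V₁ p) p (0, e 0)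
        + fderiv ℝ (fun p : ℝ × Plane => bump R p.2 * V₂ p) p (0, e 1) := by
    filter_upwards [hae] with p hp
    rw [(fderiv_bump_mul (hdf p hp)).1, (fderiv_bump_mul (hdV₁ p hp)).2.1,
      (fderiv_bump_mul (hdV₂ p hp)).2.2, hH p hp]
    ring
  rw [integral_congr_ae hfd]
  have hbc : ∀ {s : Set (ℝ × Plane)}, ContinuousOn (fun p : ℝ × Plane => bump R p.2) s :=
    (differentiable_bump R).continuous.continuousOn
  refine integral_divergence_box ![fun p => bump R p.2 * f p, fun p => bump R p.2 * V₁ p,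
    fun p => bump R p.2 * V₂ p] ht hR.le ?_ ?_ ?_ ?_ ?_
  · intro i
    fin_cases i
    exacts [hbc.mul (hf.mono hsub), hbc.mul (hV₁.mono hsub), hbc.mul (hV₂.mono hsub)]
  · intro p hp i
    have hp' : p ∈ Ioo 0 t ×ˢ (univ : Set Plane) := ⟨hp.1, mem_univ _⟩
    fin_cases i
    exacts [(differentiable_bump R p).mul (hdf p hp'), (differentiable_bump R p).mul (hdV₁ p hp'),
      (differentiable_bump R p).mul (hdV₂ p hp')]
  · intro p hp
    show bump R p.2 * V₁ p = 0
    rw [bump, hb _ (habs _ hp)]; ring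
  · intro p hp
    show bump R p.2 * V₂ p = 0
    rw [bump, hb _ (habs _ hp)]; ring
  · refine Integrable.congr ?_ hfd
    exact ((integrableOn_mul_of_continuous (continuous_bump R) hiH).add
      (integrableOn_mul_of_continuous (continuous_bump₁ R) hiV₁)).add
      (integrableOn_mul_of_continuous (continuous_bump₂ R) hiV₂)

/-- If bounded coefficients, extended by zero outside growing squares, converge pointwise to a
constant, they can be removed in the limit under the integral of an integrable function. -/
theorem tendsto_setIntegral_square_mul {α : Type*} [MeasurableSpace α] {μ : Measure α}
    {π : α → Plane} (hπ : Measurable π) {g : α → ℝ} (hg : Integrable g μ) {c : ℕ → Plane → ℝ}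
    {C l : ℝ} (hm : ∀ n, Measurable (c n)) (hc : ∀ n : ℕ, ∀ x ∈ square ((n : ℝ) + 1), |c n x| ≤ C)
    (hl : ∀ x, Tendsto (fun n => c n x) atTop (𝓝 l)) :
    Tendsto (fun n : ℕ => ∫ p in π ⁻¹' square ((n : ℝ) + 1), c n (π p) * g p ∂μ) atTop
      (𝓝 (∫ p, l * g p ∂μ)) := by
  have hms : ∀ n : ℕ, MeasurableSet (π ⁻¹' square ((n : ℝ) + 1)) :=
    fun n => hπ (measurableSet_square _)
  simp_rw [← integral_indicator (hms _)]
  refine tendsto_integral_of_dominated_convergence (fun p => C * |g p|) (fun n => ?_)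
    (hg.abs.const_mul C) (fun n => ?_) ?_
  · exact (((hm n).comp hπ).aestronglyMeasurable.mul hg.aestronglyMeasurable).indicator (hms n)
  · refine Eventually.of_forall fun p => ?_
    by_cases hp : p ∈ π ⁻¹' square ((n : ℝ) + 1)
    · rw [indicator_of_mem hp, norm_mul, Real.norm_eq_abs, Real.norm_eq_abs]
      gcongr
      exact hc n _ hp
    · rw [indicator_of_notMem hp, norm_zero]
      have : (0 : ℝ) ≤ C := (abs_nonneg _).trans (hc n (0, 0) (mem_square.2 (by
        constructor <;> simp <;> positivity)))
      positivity
  · refine Eventually.of_forall fun p => ?_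
    have hev : ∀ᶠ n : ℕ in atTop, p ∈ π ⁻¹' square ((n : ℝ) + 1) := by
      filter_upwards [eventually_ge_atTop ⌈max |(π p).1| |(π p).2|⌉₊] with n hn
      have h := Nat.ceil_le.1 hn
      exact mem_square.2 ⟨by linarith [le_max_left |(π p).1| |(π p).2|],
        by linarith [le_max_right |(π p).1| |(π p).2|]⟩
    refine ((hl (π p)).mul_const (g p)).congr' ?_
    filter_upwards [hev] with n hn
    rw [indicator_of_mem hn]

theorem tendsto_div_succ (s : ℝ) : Tendsto (fun n : ℕ => s / ((n : ℝ) + 1)) atTop (𝓝 0) :=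
  tendsto_const_nhds.div_atTop (tendsto_natCast_atTop_atTop.atTop_add tendsto_const_nhds)

theorem tendsto_bump (x : Plane) :
    Tendsto (fun n : ℕ => bump ((n : ℝ) + 1) x) atTop (𝓝 1) := by
  have h := (((tendsto_div_succ x.1).pow 2).const_sub 1).mul
    (((tendsto_div_succ x.2).pow 2).const_sub 1)
  simpa [bump] using h

theorem tendsto_bump₁ (x : Plane) :
    Tendsto (fun n : ℕ => bump₁ ((n : ℝ) + 1) x) atTop (𝓝 0) := by
  have h := (((tendsto_div_succ (2 * x.1)).mul (tendsto_div_succ 1)).neg).mul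
    (((tendsto_div_succ x.2).pow 2).const_sub 1)
  simp only [mul_zero, neg_zero, zero_mul] at h
  refine h.congr fun n => ?_
  rw [bump₁, div_mul_div_comm, mul_one, sq ((n : ℝ) + 1)]

theorem tendsto_bump₂ (x : Plane) :
    Tendsto (fun n : ℕ => bump₂ ((n : ℝ) + 1) x) atTop (𝓝 0) :=
  tendsto_bump₁ (x.2, x.1)

/-- Global balance law: if `∂ₜ f + ∂₁ V₁ + ∂₂ V₂ = H` on `(0, t) × ℝ²` with `V₁, V₂, H` integrable
in space-time and `f` integrable at the initial and final times, then the flux does not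
contribute at infinity and `∫∫ H = ∫ f(t) - ∫ f(0)`. -/
theorem integral_balance (ht : 0 ≤ t)
    (hf : ContinuousOn f (slab t)) (hV₁ : ContinuousOn V₁ (slab t))
    (hV₂ : ContinuousOn V₂ (slab t))
    (hdf : ∀ p ∈ Ioo 0 t ×ˢ (univ : Set Plane), DifferentiableAt ℝ f p)
    (hdV₁ : ∀ p ∈ Ioo 0 t ×ˢ (univ : Set Plane), DifferentiableAt ℝ V₁ p)
    (hdV₂ : ∀ p ∈ Ioo 0 t ×ˢ (univ : Set Plane), DifferentiableAt ℝ V₂ p)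
    (hH : ∀ p ∈ Ioo 0 t ×ˢ (univ : Set Plane),
      H p = fderiv ℝ f p (1, 0) + fderiv ℝ V₁ p (0, e 0) + fderiv ℝ V₂ p (0, e 1))
    (hiV₁ : IntegrableOn V₁ (slab t)) (hiV₂ : IntegrableOn V₂ (slab t))
    (hiH : IntegrableOn H (slab t)) (hit : Integrable fun x => f (t, x))
    (hi0 : Integrable fun x => f (0, x)) :
    ∫ p in slab t, H p = (∫ x, f (t, x)) - ∫ x, f (0, x) := by
  have hpos : ∀ n : ℕ, (0 : ℝ) < (n : ℝ) + 1 := fun n => by positivity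
  have h2 : ∀ n : ℕ, 2 / ((n : ℝ) + 1) ≤ 2 := fun n => by
    rw [div_le_iff₀ (hpos n)]; nlinarith [(Nat.cast_nonneg n : (0 : ℝ) ≤ n)]
  have key := fun n : ℕ =>
    integral_bump_balance ht (hpos n) hf hV₁ hV₂ hdf hdV₁ hdV₂ hH hiV₁ hiV₂ hiH
  have hset : ∀ R, (volume.restrict (slab t)).restrict (Prod.snd ⁻¹' square R)
      = volume.restrict (Icc 0 t ×ˢ square R) := fun R => by
    rw [Measure.restrict_restrict (measurable_snd (measurableSet_square R))]
    congr 1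
    ext p
    simp [slab, and_comm]
  have tH := tendsto_setIntegral_square_mul measurable_snd hiH (c := fun n : ℕ => bump ((n : ℝ) + 1))
    (fun n => (continuous_bump _).measurable) (fun n x hx => abs_bump_le (hpos n) hx) tendsto_bump
  have t1 := tendsto_setIntegral_square_mul measurable_snd hiV₁
    (c := fun n : ℕ => bump₁ ((n : ℝ) + 1)) (fun n => (continuous_bump₁ _).measurable)
    (fun n x hx => (abs_bump₁_le (hpos n) hx).trans (h2 n)) tendsto_bump₁
  have t2 := tendsto_setIntegral_square_mul measurable_snd hiV₂
    (c := fun n : ℕ => bump₂ ((n : ℝ) + 1)) (fun n => (continuous_bump₂ _).measurable)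
    (fun n x hx => (abs_bump₂_le (hpos n) hx).trans (h2 n)) tendsto_bump₂
  have tt := tendsto_setIntegral_square_mul measurable_id hit (c := fun n : ℕ => bump ((n : ℝ) + 1))
    (fun n => (continuous_bump _).measurable) (fun n x hx => abs_bump_le (hpos n) hx) tendsto_bump
  have t0 := tendsto_setIntegral_square_mul measurable_id hi0 (c := fun n : ℕ => bump ((n : ℝ) + 1))
    (fun n => (continuous_bump _).measurable) (fun n x hx => abs_bump_le (hpos n) hx) tendsto_bump
  simp only [hset] at tH t1 t2
  have lhs := (tH.add t1).add t2
  have rhs := tt.sub t0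
  simp only [one_mul, zero_mul, integral_zero, add_zero] at lhs rhs
  refine tendsto_nhds_unique lhs (rhs.congr fun n => ?_)
  have i0 := integrableOn_mul_of_continuous (R := (n : ℝ) + 1) (continuous_bump ((n : ℝ) + 1)) hiH
  have i1 := integrableOn_mul_of_continuous (R := (n : ℝ) + 1) (continuous_bump₁ ((n : ℝ) + 1)) hiV₁
  have i2 := integrableOn_mul_of_continuous (R := (n : ℝ) + 1) (continuous_bump₂ ((n : ℝ) + 1)) hiV₂
  have hadd := integral_add (i0.add i1) i2
  simp only [Pi.add_apply] at hadd
  rw [integral_add i0 i1] at hadd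
  rw [← hadd]
  exact (key n).symm

end BalanceLaw

/-! ### The weighted balance law for `∂₁²b₂` -/

theorem pd_add {f g : Plane → ℝ} (hf : Differentiable ℝ f) (hg : Differentiable ℝ g) (i : Fin 2) :
    pd i (fun x => f x + g x) = fun x => pd i f x + pd i g x := by
  funext x
  simp [pd, fderiv_fun_add (hf x) (hg x)]

theorem pd_sub {f g : Plane → ℝ} (hf : Differentiable ℝ f) (hg : Differentiable ℝ g) (i : Fin 2) :
    pd i (fun x => f x - g x) = fun x => pd i f x - pd i g x := by
  funext x
  simp [pd, fderiv_fun_sub (hf x) (hg x)]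

theorem pd_neg (f : Plane → ℝ) (i : Fin 2) : pd i (fun x => -f x) = fun x => -pd i f x := by
  funext x
  simp [pd, fderiv_fun_neg]

theorem pd_mul {f g : Plane → ℝ} (hf : Differentiable ℝ f) (hg : Differentiable ℝ g) (i : Fin 2) :
    pd i (fun x => f x * g x) = fun x => pd i f x * g x + f x * pd i g x := by
  funext x
  simp [pd, fderiv_fun_mul (hf x) (hg x)]
  ring

theorem pd_const_mul {f : Plane → ℝ} (hf : Differentiable ℝ f) (c : ℝ) (i : Fin 2) :
    pd i (fun x => c * f x) = fun x => c * pd i f x := by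
  funext x
  simp [pd, fderiv_const_mul (hf x)]

theorem differentiable_pd {f : Plane → ℝ} (hf : ContDiff ℝ 2 f) (i : Fin 2) :
    Differentiable ℝ (pd i f) :=
  (contDiff_pd (n := 1) hf i).differentiable one_ne_zero

theorem pd_pd_add {f g : Plane → ℝ} (hf : ContDiff ℝ 2 f) (hg : ContDiff ℝ 2 g) (i j : Fin 2) :
    pd j (pd i (fun x => f x + g x)) = fun x => pd j (pd i f) x + pd j (pd i g) x := by
  rw [pd_add (hf.differentiable two_ne_zero) (hg.differentiable two_ne_zero),
    pd_add (differentiable_pd hf i) (differentiable_pd hg i)]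

theorem pd_pd_mul {f g : Plane → ℝ} (hf : ContDiff ℝ 2 f) (hg : ContDiff ℝ 2 g) (i : Fin 2) :
    pd i (pd i (fun x => f x * g x)) = fun x =>
      pd i (pd i f) x * g x + 2 * (pd i f x * pd i g x) + f x * pd i (pd i g) x := by
  have hf0 := hf.differentiable two_ne_zero
  have hg0 := hg.differentiable two_ne_zero
  have hf1 := differentiable_pd hf i
  have hg1 := differentiable_pd hg i
  rw [pd_mul hf0 hg0, pd_add (hf1.fun_mul hg0) (hf0.fun_mul hg1), pd_mul hf1 hg0, pd_mul hf0 hg1]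
  funext x
  ring

/-- The right-hand side of the transport equation `∂ₜ b₂ = -u·∇b₂ + b·∇u₂ + ∂₂u₂`. -/
noncomputable def inductionRHS (u₁ u₂ b₁ b₂ : Plane → ℝ) (x : Plane) : ℝ :=
  -(u₁ x * pd 0 b₂ x + u₂ x * pd 1 b₂ x) + (b₁ x * pd 0 u₂ x + b₂ x * pd 1 u₂ x) + pd 1 u₂ x

/-- The nonlinear part of the source in the transport equation for `∂₁²b₂`, apart from the term
`3 ∂₂u₂ ∂₁²b₂`. -/
noncomputable def nonlinSource (u₂ b₁ b₂ : Plane → ℝ) (x : Plane) : ℝ :=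
  -3 * (pd 0 u₂ x * pd 0 (pd 1 b₂) x) + 3 * (pd 0 (pd 1 u₂) x * pd 0 b₂ x)
    - 3 * (pd 0 (pd 0 u₂) x * pd 1 b₂ x)
    + (b₁ x * pd 0 (pd 0 (pd 0 u₂)) x + b₂ x * pd 1 (pd 0 (pd 0 u₂)) x)

/-- The equation for `w = ∂₁²b₂`: the material derivative of `w` equals
`3 ∂₂u₂ w + nonlinSource + ∂₂∂₁²u₂`. Both divergence constraints are used to express
`∂₁u₁` and `∂₁b₁` through `∂₂u₂` and `∂₂b₂`. -/
theorem pd_pd_inductionRHS {u₁ u₂ b₁ b₂ : Plane → ℝ} (hu₁ : ContDiff ℝ 3 u₁)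
    (hu₂ : ContDiff ℝ 3 u₂) (hb₁ : ContDiff ℝ 3 b₁) (hb₂ : ContDiff ℝ 3 b₂)
    (hu : ∀ x, pd 0 u₁ x + pd 1 u₂ x = 0) (hb : ∀ x, pd 0 b₁ x + pd 1 b₂ x = 0) (x : Plane) :
    pd 0 (pd 0 (inductionRHS u₁ u₂ b₁ b₂)) x =
      -(u₁ x * pd 0 (pd 0 (pd 0 b₂)) x + u₂ x * pd 1 (pd 0 (pd 0 b₂)) x)
        + 3 * (pd 1 u₂ x * pd 0 (pd 0 b₂) x) + nonlinSource u₂ b₁ b₂ x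
        + pd 1 (pd 0 (pd 0 u₂)) x := by
  have le23 : (2 : WithTop ℕ∞) ≤ 3 := by norm_num
  have hu₁2 := hu₁.of_le le23
  have hu₂2 := hu₂.of_le le23
  have hb₁2 := hb₁.of_le le23
  have hb₂2 := hb₂.of_le le23
  have pu : ∀ i, ContDiff ℝ 2 (pd i u₂) := contDiff_pd (n := 2) hu₂
  have pb : ∀ i, ContDiff ℝ 2 (pd i b₂) := contDiff_pd (n := 2) hb₂
  have e1 : pd 0 u₁ = fun x => -pd 1 u₂ x := funext fun x => by linarith [hu x]
  have e2 : pd 0 b₁ = fun x => -pd 1 b₂ x := funext fun x => by linarith [hb x]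
  have c1 : pd 0 (pd 0 (pd 1 b₂)) = pd 1 (pd 0 (pd 0 b₂)) := by
    rw [pd_comm hb₂2 0 1, pd_comm (pb 0) 0 1]
  have c2 : pd 0 (pd 0 (pd 1 u₂)) = pd 1 (pd 0 (pd 0 u₂)) := by
    rw [pd_comm hu₂2 0 1, pd_comm (pu 0) 0 1]
  have hneg : (inductionRHS u₁ u₂ b₁ b₂) = fun x => (-1 : ℝ) * (u₁ x * pd 0 b₂ x + u₂ x * pd 1 b₂ x)
      + (b₁ x * pd 0 u₂ x + b₂ x * pd 1 u₂ x) + pd 1 u₂ x := by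
    funext x; rw [inductionRHS]; ring
  have s1 := (hu₁2.mul (pb 0)).add (hu₂2.mul (pb 1))
  have s2 := (hb₁2.mul (pu 0)).add (hb₂2.mul (pu 1))
  rw [hneg, pd_pd_add ((contDiff_const.mul s1).add s2) (pu 1), pd_pd_add (contDiff_const.mul s1) s2,
    pd_const_mul (s1.differentiable two_ne_zero), pd_const_mul (differentiable_pd s1 0),
    pd_pd_add (hu₁2.mul (pb 0)) (hu₂2.mul (pb 1)), pd_pd_add (hb₁2.mul (pu 0)) (hb₂2.mul (pu 1)),
    pd_pd_mul hu₁2 (pb 0), pd_pd_mul hu₂2 (pb 1), pd_pd_mul hb₁2 (pu 0), pd_pd_mul hb₂2 (pu 1),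
    e1, e2, pd_neg, pd_neg, c1, c2, nonlinSource]
  ring

/-- The weighted density `(b₂ - 7/2 b₂²) (∂₁²b₂)²`. The coefficient `7/2` is the one for which the
terms `b₂ ∂₂u₂ (∂₁²b₂)²` cancel in its material derivative. -/
noncomputable def density (b₂ : Plane → ℝ) (x : Plane) : ℝ :=
  (b₂ x - 7 / 2 * b₂ x ^ 2) * pd 0 (pd 0 b₂) x ^ 2

/-- First component of the flux: transport of `density`, and the integration by parts in
`b₂ ∂₁²b₂ ∂₂∂₁²u₂`. -/
noncomputable def flux₁ (u₁ u₂ b₂ : Plane → ℝ) (x : Plane) : ℝ :=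
  u₁ x * density b₂ x + 2 * (b₂ x * pd 0 (pd 1 b₂) x * pd 0 (pd 0 u₂) x)

/-- Second component of the flux. -/
noncomputable def flux₂ (u₂ b₂ : Plane → ℝ) (x : Plane) : ℝ :=
  u₂ x * density b₂ x - 2 * (b₂ x * pd 0 (pd 0 b₂) x * pd 0 (pd 0 u₂) x)

/-- The good remainder of the balance law for `density`: each of its terms is bounded in
`L¹(ℝ²)` by a multiple of `‖∂₂b‖_{H¹} ‖∇u‖_{H²}`. -/
noncomputable def remainder (u₂ b₁ b₂ : Plane → ℝ) (x : Plane) : ℝ :=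
  -7 * (b₂ x * (b₁ x * pd 0 u₂ x + b₂ x * pd 1 u₂ x) * pd 0 (pd 0 b₂) x ^ 2)
    + 2 * (b₂ x * pd 0 (pd 0 b₂) x * nonlinSource u₂ b₁ b₂ x)
    - 7 * (b₂ x ^ 2 * pd 0 (pd 0 b₂) x * (3 * (pd 1 u₂ x * pd 0 (pd 0 b₂) x)
        + nonlinSource u₂ b₁ b₂ x + pd 1 (pd 0 (pd 0 u₂)) x))
    - 2 * (pd 1 b₂ x * pd 0 (pd 0 b₂) x * pd 0 (pd 0 u₂) x)
    + 2 * (pd 0 b₂ x * pd 0 (pd 1 b₂) x * pd 0 (pd 0 u₂) x)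
    + 2 * (b₂ x * pd 0 (pd 1 b₂) x * pd 0 (pd 0 (pd 0 u₂)) x)

/-- The balance law for `density` at a fixed time, with `bt` and `wt` standing for the time
derivatives of `b₂` and of `∂₁²b₂`. -/
theorem density_balance {u₁ u₂ b₁ b₂ : Plane → ℝ} (hu₁ : ContDiff ℝ 3 u₁)
    (hu₂ : ContDiff ℝ 3 u₂) (hb₁ : ContDiff ℝ 3 b₁) (hb₂ : ContDiff ℝ 3 b₂)
    (hu : ∀ x, pd 0 u₁ x + pd 1 u₂ x = 0) (hb : ∀ x, pd 0 b₁ x + pd 1 b₂ x = 0) (x : Plane)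
    {bt wt : ℝ} (hbt : bt = inductionRHS u₁ u₂ b₁ b₂ x)
    (hwt : wt = pd 0 (pd 0 (inductionRHS u₁ u₂ b₁ b₂)) x) :
    ((1 - 7 * b₂ x) * bt * pd 0 (pd 0 b₂) x ^ 2
        + (b₂ x - 7 / 2 * b₂ x ^ 2) * (2 * pd 0 (pd 0 b₂) x * wt))
      + pd 0 (flux₁ u₁ u₂ b₂) x + pd 1 (flux₂ u₂ b₂) x
    = pd 1 u₂ x * pd 0 (pd 0 b₂) x ^ 2 + b₁ x * pd 0 u₂ x * pd 0 (pd 0 b₂) x ^ 2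
      + remainder u₂ b₁ b₂ x := by
  have le23 : (2 : WithTop ℕ∞) ≤ 3 := by norm_num
  have du₁ := hu₁.differentiable three_ne_zero
  have du₂ := hu₂.differentiable three_ne_zero
  have db₂ := hb₂.differentiable three_ne_zero
  have pu : ∀ i, ContDiff ℝ 2 (pd i u₂) := contDiff_pd (n := 2) hu₂
  have pb : ∀ i, ContDiff ℝ 2 (pd i b₂) := contDiff_pd (n := 2) hb₂
  have dw := differentiable_pd (pb 0) 0
  have dv := differentiable_pd (pb 1) 0
  have duu := differentiable_pd (pu 0) 0
  have dF : Differentiable ℝ fun x => b₂ x - 7 / 2 * (b₂ x * b₂ x) :=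
    db₂.sub ((db₂.fun_mul db₂).const_mul _)
  have c1 : pd 0 (pd 0 (pd 1 b₂)) = pd 1 (pd 0 (pd 0 b₂)) := by
    rw [pd_comm (hb₂.of_le le23) 0 1, pd_comm (pb 0) 0 1]
  have hdens : density b₂ = fun x => (b₂ x - 7 / 2 * (b₂ x * b₂ x))
      * (pd 0 (pd 0 b₂) x * pd 0 (pd 0 b₂) x) := by
    funext x; rw [density]; ring
  have ddens : Differentiable ℝ (density b₂) := by rw [hdens]; exact dF.fun_mul (dw.fun_mul dw)
  have hd : ∀ i, pd i (density b₂) = fun x =>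
      (1 - 7 * b₂ x) * pd i b₂ x * pd 0 (pd 0 b₂) x ^ 2
        + (b₂ x - 7 / 2 * b₂ x ^ 2) * (2 * pd 0 (pd 0 b₂) x * pd i (pd 0 (pd 0 b₂)) x) :=
    fun i => by
      rw [hdens, pd_mul dF (dw.fun_mul dw), pd_sub db₂ ((db₂.fun_mul db₂).const_mul _),
        pd_const_mul (db₂.fun_mul db₂), pd_mul db₂ db₂, pd_mul dw dw]
      funext x
      ring
  have h1 : pd 0 (flux₁ u₁ u₂ b₂) x = (pd 0 u₁ x * density b₂ x + u₁ x * pd 0 (density b₂) x)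
      + 2 * ((pd 0 b₂ x * pd 0 (pd 1 b₂) x + b₂ x * pd 0 (pd 0 (pd 1 b₂)) x) * pd 0 (pd 0 u₂) x
        + b₂ x * pd 0 (pd 1 b₂) x * pd 0 (pd 0 (pd 0 u₂)) x) := by
    unfold flux₁
    rw [pd_add (du₁.fun_mul ddens) (((db₂.fun_mul dv).fun_mul duu).const_mul _), pd_mul du₁ ddens,
      pd_const_mul ((db₂.fun_mul dv).fun_mul duu), pd_mul (db₂.fun_mul dv) duu, pd_mul db₂ dv]
  have h2 : pd 1 (flux₂ u₂ b₂) x = (pd 1 u₂ x * density b₂ x + u₂ x * pd 1 (density b₂) x)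
      - 2 * ((pd 1 b₂ x * pd 0 (pd 0 b₂) x + b₂ x * pd 1 (pd 0 (pd 0 b₂)) x) * pd 0 (pd 0 u₂) x
        + b₂ x * pd 0 (pd 0 b₂) x * pd 1 (pd 0 (pd 0 u₂)) x) := by
    unfold flux₂
    rw [pd_sub (du₂.fun_mul ddens) (((db₂.fun_mul dw).fun_mul duu).const_mul _), pd_mul du₂ ddens,
      pd_const_mul ((db₂.fun_mul dw).fun_mul duu), pd_mul (db₂.fun_mul dw) duu, pd_mul db₂ dw]
  have e1 : pd 0 u₁ x = -pd 1 u₂ x := by linarith [hu x]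
  rw [h1, h2, hd, hd, c1, hbt, hwt, pd_pd_inductionRHS hu₁ hu₂ hb₁ hb₂ hu hb, e1, inductionRHS,
    remainder]
  ring

/-! ### Estimates at a fixed time -/

theorem l2_add_le {f g : Plane → ℝ} (hf : Continuous f) (hg : Continuous g) {a c : ℝ≥0∞}
    (ha : l2 f ≤ a) (hc : l2 g ≤ c) : l2 (fun x => f x + g x) ≤ a + c := by
  have h : ∀ f : Plane → ℝ, l2 f = eLpNorm f 2 volume := fun f => by
    rw [eLpNorm_eq_lintegral_rpow_enorm_toReal two_ne_zero ENNReal.ofNat_ne_top]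
    simp [l2, l2Sq]
  rw [h] at *
  exact (eLpNorm_add_le hf.aestronglyMeasurable hg.aestronglyMeasurable one_le_two).trans
    (add_le_add ha hc)

theorem l2_const_mul_le {f : Plane → ℝ} {a k : ℝ≥0∞} {c : ℝ} (hc : ‖c‖ₑ = k) (ha : l2 f ≤ a) :
    l2 (fun x => c * f x) ≤ k * a := by
  refine (l2_mul_le_of_bound (f := fun _ => c) (c := k) ?_ fun _ => hc.le).trans (by gcongr)
  rw [← hc]; exact enorm_ne_top

theorem l2_mul_le_of_l2 {f g : Plane → ℝ} (hf : ContDiff ℝ 1 f) (hg : ContDiff ℝ 1 g)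
    {a a' c : ℝ≥0∞} (ha : a < ∞) (hc : c < ∞) (h1 : l2 f ≤ a) (h2 : l2 (pd 1 f) ≤ a')
    (h3 : l2 g ≤ c) (h4 : l2 (pd 0 g) ≤ c) :
    l2Sq (fun x => f x * g x) ≤ 4 * (a * a' * (c * c)) :=
  (l2Sq_mul_le hf hg (h1.trans_lt ha) (h3.trans_lt hc)).trans (by gcongr)

/-- The smoothness and the `L²` bounds on the magnetic field at a fixed time: `e` bounds
`‖b‖_{H²}` and `β` bounds `‖∂₂b‖_{H¹}`. -/
structure MagneticBounds (b₁ b₂ : Plane → ℝ) (e β : ℝ≥0∞) : Prop where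
  b₁_smooth : ContDiff ℝ 3 b₁
  b₂_smooth : ContDiff ℝ 3 b₂
  e_lt : e < ∞
  β_le : β ≤ e
  b₁_le : l2 b₁ ≤ e
  b₂_le : l2 b₂ ≤ e
  pd_b₁_le : ∀ i, l2 (pd i b₁) ≤ e
  pd_b₂_le : ∀ i, l2 (pd i b₂) ≤ e
  pd_pd_b₂_le : ∀ i j, l2 (pd i (pd j b₂)) ≤ e
  pd1_b₁_le : l2 (pd 1 b₁) ≤ β
  pd1_b₂_le : l2 (pd 1 b₂) ≤ β
  pd_pd1_b₁_le : ∀ i, l2 (pd i (pd 1 b₁)) ≤ β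
  pd_pd1_b₂_le : ∀ i, l2 (pd i (pd 1 b₂)) ≤ β

/-- The bounds available at almost every time: those on the magnetic field, and the finite bound
`μ` for `‖∇u₂‖_{H²}`. -/
structure FixedTimeBounds (u₂ b₁ b₂ : Plane → ℝ) (e β μ : ℝ≥0∞) : Prop
    extends MagneticBounds b₁ b₂ e β where
  u₂_smooth : ContDiff ℝ 3 u₂
  μ_lt : μ < ∞
  pd_u₂_le : ∀ i, l2 (pd i u₂) ≤ μ
  pd_pd_u₂_le : ∀ i j, l2 (pd i (pd j u₂)) ≤ μ
  pd_pd_pd_u₂_le : ∀ i j k, l2 (pd i (pd j (pd k u₂))) ≤ μ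

theorem sq_four_mul (a : ℝ≥0∞) : 4 * (a * a) = (2 * a) ^ 2 := by ring

theorem le_two_mul_of_sq {a c : ℝ≥0∞} (h : a ^ 2 ≤ 4 * (c * c)) : a ≤ 2 * c := by
  rw [sq_four_mul] at h
  exact (ENNReal.pow_le_pow_left_iff two_ne_zero).1 h

theorem enorm_three : ‖(3 : ℝ)‖ₑ = 3 := by rw [Real.enorm_eq_ofReal (by norm_num)]; simp
theorem enorm_neg_three : ‖(-3 : ℝ)‖ₑ = 3 := by rw [enorm_neg, enorm_three]
theorem enorm_two : ‖(2 : ℝ)‖ₑ = 2 := by rw [Real.enorm_eq_ofReal (by norm_num)]; simp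
theorem enorm_neg_two : ‖(-2 : ℝ)‖ₑ = 2 := by rw [enorm_neg, enorm_two]
theorem enorm_neg_seven : ‖(-7 : ℝ)‖ₑ = 7 := by
  rw [enorm_neg, Real.enorm_eq_ofReal (by norm_num)]; simp

theorem lintegral_mul_sq_le {f w : Plane → ℝ} {c a : ℝ≥0∞} (hc : c ≠ ∞) (hf : ∀ x, ‖f x‖ₑ ≤ c)
    (hw : l2 w ≤ a) : ∫⁻ x, ‖f x * w x ^ 2‖ₑ ≤ c * a ^ 2 := by
  calc ∫⁻ x, ‖f x * w x ^ 2‖ₑ ≤ ∫⁻ x, c * ‖w x‖ₑ ^ 2 := by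
        refine lintegral_mono fun x => ?_
        rw [enorm_mul, enorm_pow]
        gcongr
        exact hf x
    _ = c * l2 w ^ 2 := by rw [lintegral_const_mul' _ _ hc, l2_sq, l2Sq]
    _ ≤ _ := by gcongr

namespace MagneticBounds

variable {b₁ b₂ : Plane → ℝ} {e β : ℝ≥0∞}

theorem β_lt (h : MagneticBounds b₁ b₂ e β) : β < ∞ := h.β_le.trans_lt h.e_lt

theorem enorm_b₁_sq_le (h : MagneticBounds b₁ b₂ e β) (x : Plane) :
    ‖b₁ x‖ₑ ^ 2 ≤ 4 * (e * β) :=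
  enorm_sq_le_of_l2 (h.b₁_smooth.of_le (by norm_num)) h.e_lt h.β_lt h.b₁_le (h.pd_b₁_le 0)
    h.pd1_b₁_le (h.pd_pd1_b₁_le 0) x

theorem enorm_b₂_sq_le (h : MagneticBounds b₁ b₂ e β) (x : Plane) :
    ‖b₂ x‖ₑ ^ 2 ≤ 4 * (e * β) :=
  enorm_sq_le_of_l2 (h.b₂_smooth.of_le (by norm_num)) h.e_lt h.β_lt h.b₂_le (h.pd_b₂_le 0)
    h.pd1_b₂_le (h.pd_pd1_b₂_le 0) x

theorem enorm_b₁_le (h : MagneticBounds b₁ b₂ e β) (x : Plane) : ‖b₁ x‖ₑ ≤ 2 * e :=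
  le_two_mul_of_sq ((h.enorm_b₁_sq_le x).trans (by gcongr; exact h.β_le))

theorem enorm_b₂_le (h : MagneticBounds b₁ b₂ e β) (x : Plane) : ‖b₂ x‖ₑ ≤ 2 * e :=
  le_two_mul_of_sq ((h.enorm_b₂_sq_le x).trans (by gcongr; exact h.β_le))

theorem enorm_b₂_mul_b₁_le (h : MagneticBounds b₁ b₂ e β) (x : Plane) :
    ‖b₂ x * b₁ x‖ₑ ≤ 4 * (e * β) := by
  refine (ENNReal.pow_le_pow_left_iff two_ne_zero).1 ?_
  rw [enorm_mul, mul_pow, sq (4 * (e * β))]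
  exact mul_le_mul' (h.enorm_b₂_sq_le x) (h.enorm_b₁_sq_le x)

theorem enorm_b₂_mul_b₂_le (h : MagneticBounds b₁ b₂ e β) (x : Plane) :
    ‖b₂ x * b₂ x‖ₑ ≤ 4 * (e * β) := by
  rw [enorm_mul, ← sq]
  exact h.enorm_b₂_sq_le x

theorem contDiff_pd_b₂ (h : MagneticBounds b₁ b₂ e β) (i : Fin 2) : ContDiff ℝ 2 (pd i b₂) :=
  contDiff_pd (n := 2) h.b₂_smooth i

theorem contDiff_pd_pd_b₂ (h : MagneticBounds b₁ b₂ e β) (i j : Fin 2) :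
    ContDiff ℝ 1 (pd i (pd j b₂)) :=
  contDiff_pd (n := 1) (h.contDiff_pd_b₂ j) i

theorem two_mul_e_ne_top (h : MagneticBounds b₁ b₂ e β) : 2 * e ≠ ∞ := by
  have := h.e_lt; finiteness

theorem four_mul_ne_top (h : MagneticBounds b₁ b₂ e β) : 4 * (e * β) ≠ ∞ := by
  have := h.e_lt; have := h.β_lt; finiteness

theorem lintegral_density_le (h : MagneticBounds b₁ b₂ e β) :
    ∫⁻ x, ‖density b₂ x‖ₑ ≤ (2 * e + 14 * e ^ 2) * e ^ 2 := by
  have := h.e_lt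
  refine lintegral_mul_sq_le (by finiteness) (fun x => ?_) (h.pd_pd_b₂_le 0 0)
  have h72 : ‖(7 / 2 : ℝ)‖ₑ * 4 = 14 := by
    rw [Real.enorm_eq_ofReal (by norm_num), ← ENNReal.ofReal_ofNat 4,
      ← ENNReal.ofReal_mul (by norm_num)]
    norm_num
  calc ‖b₂ x - 7 / 2 * b₂ x ^ 2‖ₑ ≤ ‖b₂ x‖ₑ + ‖(7 / 2 : ℝ)‖ₑ * ‖b₂ x‖ₑ ^ 2 := by
        rw [← enorm_pow, ← enorm_mul]; exact enorm_sub_le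
    _ ≤ 2 * e + ‖(7 / 2 : ℝ)‖ₑ * (2 * e) ^ 2 := by gcongr <;> exact h.enorm_b₂_le x
    _ = 2 * e + ‖(7 / 2 : ℝ)‖ₑ * 4 * e ^ 2 := by ring
    _ = _ := by rw [h72]

end MagneticBounds

namespace FixedTimeBounds

variable {u₂ b₁ b₂ : Plane → ℝ} {e β μ : ℝ≥0∞}

theorem enorm_pd_u₂_le (h : FixedTimeBounds u₂ b₁ b₂ e β μ) (i : Fin 2) (x : Plane) :
    ‖pd i u₂ x‖ₑ ≤ 2 * μ :=
  le_two_mul_of_sq (enorm_sq_le_of_l2 (contDiff_pd (n := 2) h.u₂_smooth i) h.μ_lt h.μ_lt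
    (h.pd_u₂_le i) (h.pd_pd_u₂_le 0 i) (h.pd_pd_u₂_le 1 i) (h.pd_pd_pd_u₂_le 0 1 i) x)

theorem contDiff_pd_u₂ (h : FixedTimeBounds u₂ b₁ b₂ e β μ) (i : Fin 2) : ContDiff ℝ 2 (pd i u₂) :=
  contDiff_pd (n := 2) h.u₂_smooth i

theorem contDiff_pd_pd_u₂ (h : FixedTimeBounds u₂ b₁ b₂ e β μ) (i j : Fin 2) :
    ContDiff ℝ 1 (pd i (pd j u₂)) :=
  contDiff_pd (n := 1) (h.contDiff_pd_u₂ j) i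

theorem two_mul_μ_ne_top (h : FixedTimeBounds u₂ b₁ b₂ e β μ) : 2 * μ ≠ ∞ := by
  have := h.μ_lt; finiteness

theorem l2_pd_u₂_mul_le (h : FixedTimeBounds u₂ b₁ b₂ e β μ) (i : Fin 2) {f : Plane → ℝ}
    {a : ℝ≥0∞} (hf : l2 f ≤ a) : l2 (fun x => pd i u₂ x * f x) ≤ 2 * μ * a :=
  (l2_mul_le_of_bound h.two_mul_μ_ne_top (h.enorm_pd_u₂_le i)).trans (by gcongr)

theorem l2_b₂_mul_le (h : FixedTimeBounds u₂ b₁ b₂ e β μ) {f : Plane → ℝ}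
    {a : ℝ≥0∞} (hf : l2 f ≤ a) : l2 (fun x => b₂ x * f x) ≤ 2 * e * a :=
  (l2_mul_le_of_bound h.two_mul_e_ne_top h.enorm_b₂_le).trans (by gcongr)

theorem l2_b₁_mul_le (h : FixedTimeBounds u₂ b₁ b₂ e β μ) {f : Plane → ℝ}
    {a : ℝ≥0∞} (hf : l2 f ≤ a) : l2 (fun x => b₁ x * f x) ≤ 2 * e * a :=
  (l2_mul_le_of_bound h.two_mul_e_ne_top h.enorm_b₁_le).trans (by gcongr)

theorem l2_b₂_b₂_mul_le (h : FixedTimeBounds u₂ b₁ b₂ e β μ) {f : Plane → ℝ}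
    {a : ℝ≥0∞} (hf : l2 f ≤ a) : l2 (fun x => b₂ x * b₂ x * f x) ≤ 4 * (e * β) * a :=
  (l2_mul_le_of_bound (f := fun x => b₂ x * b₂ x) h.four_mul_ne_top h.enorm_b₂_mul_b₂_le).trans
    (by gcongr)

theorem l2_b₂_b₁_mul_le (h : FixedTimeBounds u₂ b₁ b₂ e β μ) {f : Plane → ℝ}
    {a : ℝ≥0∞} (hf : l2 f ≤ a) : l2 (fun x => b₂ x * b₁ x * f x) ≤ 4 * (e * β) * a :=
  (l2_mul_le_of_bound (f := fun x => b₂ x * b₁ x) h.four_mul_ne_top h.enorm_b₂_mul_b₁_le).trans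
    (by gcongr)

theorem l2Sq_pd0_b₂_mul_le (h : FixedTimeBounds u₂ b₁ b₂ e β μ) (i j : Fin 2) :
    l2Sq (fun x => pd 0 b₂ x * pd i (pd j u₂) x) ≤ 4 * (e * β * (μ * μ)) := by
  refine l2_mul_le_of_l2 ((h.contDiff_pd_b₂ 0).of_le (by norm_num)) (h.contDiff_pd_pd_u₂ i j)
    h.e_lt h.μ_lt (h.pd_b₂_le 0) ?_ (h.pd_pd_u₂_le i j) (h.pd_pd_pd_u₂_le 0 i j)
  rw [pd_comm (h.b₂_smooth.of_le (by norm_num))]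
  exact h.pd_pd1_b₂_le 0

theorem l2_pd0_b₂_mul_le (h : FixedTimeBounds u₂ b₁ b₂ e β μ) (i j : Fin 2) :
    l2 (fun x => pd 0 b₂ x * pd i (pd j u₂) x) ≤ 2 * (e * μ) := by
  refine l2_le_of_sq_le ((h.l2Sq_pd0_b₂_mul_le i j).trans ?_)
  calc 4 * (e * β * (μ * μ)) ≤ 4 * (e * e * (μ * μ)) := by gcongr; exact h.β_le
    _ = _ := by ring

theorem l2_pd1_b₂_mul_le (h : FixedTimeBounds u₂ b₁ b₂ e β μ) (i j : Fin 2) :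
    l2 (fun x => pd 1 b₂ x * pd i (pd j u₂) x) ≤ 2 * (β * μ) := by
  refine l2_le_of_sq_le ((l2_mul_le_of_l2 ((h.contDiff_pd_b₂ 1).of_le (by norm_num))
    (h.contDiff_pd_pd_u₂ i j) h.β_lt h.μ_lt h.pd1_b₂_le (h.pd_pd1_b₂_le 1) (h.pd_pd_u₂_le i j)
    (h.pd_pd_pd_u₂_le 0 i j)).trans_eq ?_)
  ring

/-- In `b₂ ∂₁b₂ ∇²u₂` both magnetic factors contribute half a power of `β`. -/
theorem l2_b₂_mul_pd0_b₂_mul_le (h : FixedTimeBounds u₂ b₁ b₂ e β μ) (i j : Fin 2) :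
    l2 (fun x => b₂ x * (pd 0 b₂ x * pd i (pd j u₂) x)) ≤ 4 * (e * β) * μ := by
  refine l2_le_of_sq_le ?_
  calc l2Sq (fun x => b₂ x * (pd 0 b₂ x * pd i (pd j u₂) x))
      ≤ ∫⁻ x, 4 * (e * β) * ‖pd 0 b₂ x * pd i (pd j u₂) x‖ₑ ^ 2 := by
        refine lintegral_mono fun x => ?_
        rw [enorm_mul, mul_pow]
        gcongr
        exact h.enorm_b₂_sq_le x
    _ = 4 * (e * β) * l2Sq (fun x => pd 0 b₂ x * pd i (pd j u₂) x) :=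
        lintegral_const_mul' _ _ h.four_mul_ne_top
    _ ≤ 4 * (e * β) * (4 * (e * β * (μ * μ))) := by gcongr; exact h.l2Sq_pd0_b₂_mul_le i j
    _ = _ := by ring

/-- All the factors that occur are continuous. -/
theorem continuity (h : FixedTimeBounds u₂ b₁ b₂ e β μ) :
    Continuous b₁ ∧ Continuous b₂ ∧ (∀ i, Continuous (pd i b₂)) ∧ (∀ i, Continuous (pd i u₂)) ∧
    (∀ i j, Continuous (pd i (pd j b₂))) ∧ (∀ i j, Continuous (pd i (pd j u₂))) ∧
    (∀ i j k, Continuous (pd i (pd j (pd k u₂)))) :=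
  ⟨h.b₁_smooth.continuous, h.b₂_smooth.continuous, fun i => (h.contDiff_pd_b₂ i).continuous,
    fun i => (h.contDiff_pd_u₂ i).continuous, fun i j => (h.contDiff_pd_pd_b₂ i j).continuous,
    fun i j => (h.contDiff_pd_pd_u₂ i j).continuous,
    fun i j k => continuous_pd (h.contDiff_pd_pd_u₂ j k) i⟩

theorem continuous_nonlinSource (h : FixedTimeBounds u₂ b₁ b₂ e β μ) :
    Continuous (nonlinSource u₂ b₁ b₂) := by
  obtain ⟨c1, c2, c3, c4, c5, c6, c7⟩ := h.continuity
  unfold nonlinSource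
  fun_prop

theorem l2_nonlinSource_le (h : FixedTimeBounds u₂ b₁ b₂ e β μ) :
    l2 (nonlinSource u₂ b₁ b₂) ≤ 22 * (e * μ) := by
  obtain ⟨c1, c2, c3, c4, c5, c6, c7⟩ := h.continuity
  have hN : nonlinSource u₂ b₁ b₂ = fun x => -3 * (pd 0 u₂ x * pd 0 (pd 1 b₂) x)
      + (3 * (pd 0 b₂ x * pd 0 (pd 1 u₂) x) + (-3 * (pd 1 b₂ x * pd 0 (pd 0 u₂) x)
      + (b₁ x * pd 0 (pd 0 (pd 0 u₂)) x + b₂ x * pd 1 (pd 0 (pd 0 u₂)) x))) := by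
    funext x; rw [nonlinSource]; ring
  rw [hN]
  calc _ ≤ 3 * (2 * μ * e) + (3 * (2 * (e * μ)) + (3 * (2 * (e * μ))
        + (2 * e * μ + 2 * e * μ))) := by
        refine l2_add_le (by fun_prop) (by fun_prop)
          (l2_const_mul_le enorm_neg_three (h.l2_pd_u₂_mul_le 0 (h.pd_pd_b₂_le 0 1))) ?_
        refine l2_add_le (by fun_prop) (by fun_prop)
          (l2_const_mul_le enorm_three (h.l2_pd0_b₂_mul_le 0 1)) ?_
        refine l2_add_le (by fun_prop) (by fun_prop)
          (l2_const_mul_le enorm_neg_three ((h.l2_pd1_b₂_mul_le 0 0).trans ?_)) ?_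
        · gcongr; exact h.β_le
        exact l2_add_le (by fun_prop) (by fun_prop) (h.l2_b₁_mul_le (h.pd_pd_pd_u₂_le 0 0 0))
          (h.l2_b₂_mul_le (h.pd_pd_pd_u₂_le 1 0 0))
    _ = _ := by ring

theorem l2_b₂_mul_nonlinSource_le (h : FixedTimeBounds u₂ b₁ b₂ e β μ) :
    l2 (fun x => b₂ x * nonlinSource u₂ b₁ b₂ x) ≤ 44 * (e * (β * μ)) := by
  obtain ⟨c1, c2, c3, c4, c5, c6, c7⟩ := h.continuity
  have hN : (fun x => b₂ x * nonlinSource u₂ b₁ b₂ x)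
      = fun x => -3 * (b₂ x * (pd 0 u₂ x * pd 0 (pd 1 b₂) x))
      + (3 * (b₂ x * (pd 0 b₂ x * pd 0 (pd 1 u₂) x))
      + (-3 * (b₂ x * (pd 1 b₂ x * pd 0 (pd 0 u₂) x))
      + (b₂ x * b₁ x * pd 0 (pd 0 (pd 0 u₂)) x + b₂ x * b₂ x * pd 1 (pd 0 (pd 0 u₂)) x))) := by
    funext x; rw [nonlinSource]; ring
  rw [hN]
  calc _ ≤ 3 * (2 * e * (2 * μ * β)) + (3 * (4 * (e * β) * μ) + (3 * (2 * e * (2 * (β * μ)))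
        + (4 * (e * β) * μ + 4 * (e * β) * μ))) := by
        refine l2_add_le (by fun_prop) (by fun_prop) (l2_const_mul_le enorm_neg_three
          (h.l2_b₂_mul_le (h.l2_pd_u₂_mul_le 0 (h.pd_pd1_b₂_le 0)))) ?_
        refine l2_add_le (by fun_prop) (by fun_prop)
          (l2_const_mul_le enorm_three (h.l2_b₂_mul_pd0_b₂_mul_le 0 1)) ?_
        refine l2_add_le (by fun_prop) (by fun_prop)
          (l2_const_mul_le enorm_neg_three (h.l2_b₂_mul_le (h.l2_pd1_b₂_mul_le 0 0))) ?_
        exact l2_add_le (by fun_prop) (by fun_prop)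
          (h.l2_b₂_b₁_mul_le (h.pd_pd_pd_u₂_le 0 0 0)) (h.l2_b₂_b₂_mul_le (h.pd_pd_pd_u₂_le 1 0 0))
    _ = _ := by ring

/-- The remainder is quadratic in the quantities `β`, `μ` that are square integrable in time. -/
theorem lintegral_remainder_le (h : FixedTimeBounds u₂ b₁ b₂ e β μ) :
    ∫⁻ x, ‖remainder u₂ b₁ b₂ x‖ₑ ≤ 1000 * (e + e ^ 2 + e ^ 3) * (β * μ) := by
  obtain ⟨c1, c2, c3, c4, c5, c6, c7⟩ := h.continuity
  have cN := h.continuous_nonlinSource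
  set N := nonlinSource u₂ b₁ b₂ with hN
  set w := pd 0 (pd 0 b₂) with hw
  -- Grouping by the factor taken out in `L²`: `∂₁²b₂` in most terms, `∂₁∂₂b₂` in the last two.
  set Q : Plane → ℝ := fun x =>
    -7 * (b₂ x * b₁ x * (pd 0 u₂ x * w x) + b₂ x * b₂ x * (pd 1 u₂ x * w x))
    + (2 * (b₂ x * N x) + (-7 * (b₂ x * b₂ x * (3 * (pd 1 u₂ x * w x)
      + (N x + pd 1 (pd 0 (pd 0 u₂)) x))) + -2 * (pd 1 b₂ x * pd 0 (pd 0 u₂) x))) with hQ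
  set Q' : Plane → ℝ := fun x => 2 * (pd 0 b₂ x * pd 0 (pd 0 u₂) x)
    + 2 * (b₂ x * pd 0 (pd 0 (pd 0 u₂)) x) with hQ'
  have cQ : Continuous Q := by rw [hQ]; fun_prop
  have cQ' : Continuous Q' := by rw [hQ']; fun_prop
  have hR : ∀ x, remainder u₂ b₁ b₂ x = w x * Q x + pd 0 (pd 1 b₂) x * Q' x := fun x => by
    simp only [remainder, hQ, hQ']; ring
  have lw : l2 w ≤ e := h.pd_pd_b₂_le 0 0
  have lQ : l2 Q ≤ 7 * (4 * (e * β) * (2 * μ * e) + 4 * (e * β) * (2 * μ * e))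
      + (2 * (44 * (e * (β * μ))) + (7 * (4 * (e * β) * (3 * (2 * μ * e) + (22 * (e * μ) + μ)))
        + 2 * (2 * (β * μ)))) := by
    refine l2_add_le (by fun_prop) (by fun_prop) (l2_const_mul_le enorm_neg_seven
      (l2_add_le (by fun_prop) (by fun_prop) (h.l2_b₂_b₁_mul_le (h.l2_pd_u₂_mul_le 0 lw))
        (h.l2_b₂_b₂_mul_le (h.l2_pd_u₂_mul_le 1 lw)))) ?_
    refine l2_add_le (by fun_prop) (by fun_prop)
      (l2_const_mul_le enorm_two h.l2_b₂_mul_nonlinSource_le) ?_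
    refine l2_add_le (by fun_prop) (by fun_prop) (l2_const_mul_le enorm_neg_seven
      (h.l2_b₂_b₂_mul_le (l2_add_le (by fun_prop) (by fun_prop)
        (l2_const_mul_le enorm_three (h.l2_pd_u₂_mul_le 1 lw))
        (l2_add_le (by fun_prop) (by fun_prop) h.l2_nonlinSource_le
          (h.pd_pd_pd_u₂_le 1 0 0))))) ?_
    exact l2_const_mul_le enorm_neg_two (h.l2_pd1_b₂_mul_le 0 0)
  have lQ' : l2 Q' ≤ 2 * (2 * (e * μ)) + 2 * (2 * e * μ) :=
    l2_add_le (by fun_prop) (by fun_prop) (l2_const_mul_le enorm_two (h.l2_pd0_b₂_mul_le 0 0))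
      (l2_const_mul_le enorm_two (h.l2_b₂_mul_le (h.pd_pd_pd_u₂_le 0 0 0)))
  calc ∫⁻ x, ‖remainder u₂ b₁ b₂ x‖ₑ
      ≤ ∫⁻ x, (‖w x‖ₑ * ‖Q x‖ₑ + ‖pd 0 (pd 1 b₂) x‖ₑ * ‖Q' x‖ₑ) := by
        refine lintegral_mono fun x => ?_
        rw [hR, ← enorm_mul, ← enorm_mul]
        exact enorm_add_le _ _
    _ = (∫⁻ x, ‖w x‖ₑ * ‖Q x‖ₑ) + ∫⁻ x, ‖pd 0 (pd 1 b₂) x‖ₑ * ‖Q' x‖ₑ :=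
        lintegral_add_left ((c5 0 0).measurable.enorm.mul cQ.measurable.enorm) _
    _ ≤ l2 w * l2 Q + l2 (pd 0 (pd 1 b₂)) * l2 Q' :=
        add_le_add (lintegral_mul_le_l2 (c5 0 0) cQ) (lintegral_mul_le_l2 (c5 0 1) cQ')
    _ ≤ e * _ + β * _ := add_le_add (mul_le_mul' lw lQ) (mul_le_mul' (h.pd_pd1_b₂_le 0) lQ')
    _ ≤ 1000 * (e + e ^ 2 + e ^ 3) * (β * μ) := by
        -- The added nonnegative quantity is the difference of the two sides.
        refine le_of_le_of_eq (le_add_of_nonneg_right (zero_le :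
          0 ≤ 988 * (e * (β * μ)) + 884 * (e ^ 2 * (β * μ)) + 104 * (e ^ 3 * (β * μ)))) ?_
        ring

theorem lintegral_pd1_u₂_mul_le (h : FixedTimeBounds u₂ b₁ b₂ e β μ) :
    ∫⁻ x, ‖pd 1 u₂ x * pd 0 (pd 0 b₂) x ^ 2‖ₑ ≤ 2 * μ * e ^ 2 :=
  lintegral_mul_sq_le h.two_mul_μ_ne_top (h.enorm_pd_u₂_le 1) (h.pd_pd_b₂_le 0 0)

theorem l2Sq_pd0_u₂_mul_le (h : FixedTimeBounds u₂ b₁ b₂ e β μ) :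
    l2Sq (fun x => pd 0 u₂ x * pd 0 (pd 0 b₂) x) ≤ 4 * e ^ 2 * μ ^ 2 := by
  rw [← l2_sq]
  calc _ ≤ (2 * μ * e) ^ 2 := by
        gcongr; exact h.l2_pd_u₂_mul_le 0 (h.pd_pd_b₂_le 0 0)
    _ = _ := by ring

theorem lintegral_flux_le (h : FixedTimeBounds u₂ b₁ b₂ e β μ) {v : Plane → ℝ}
    (hve : ∀ x, ‖v x‖ₑ ≤ 2 * e) (i : Fin 2) {c : ℝ} (hc : ‖c‖ₑ = 2) :
    ∫⁻ x, ‖v x * density b₂ x + c * (b₂ x * pd 0 (pd i b₂) x * pd 0 (pd 0 u₂) x)‖ₑ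
      ≤ 2 * e * ((2 * e + 14 * e ^ 2) * e ^ 2) + 4 * e ^ 2 * μ := by
  obtain ⟨c1, c2, c3, c4, c5, c6, c7⟩ := h.continuity
  have cd : Continuous (density b₂) := by unfold density; fun_prop
  calc _ ≤ ∫⁻ x, (2 * e * ‖density b₂ x‖ₑ
          + 4 * e * (‖pd 0 (pd i b₂) x‖ₑ * ‖pd 0 (pd 0 u₂) x‖ₑ)) := by
        refine lintegral_mono fun x => (enorm_add_le _ _).trans (add_le_add ?_ ?_)
        · rw [enorm_mul]; gcongr; exact hve x
        · rw [enorm_mul, hc, enorm_mul, enorm_mul]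
          calc 2 * (‖b₂ x‖ₑ * ‖pd 0 (pd i b₂) x‖ₑ * ‖pd 0 (pd 0 u₂) x‖ₑ)
              ≤ 2 * (2 * e * ‖pd 0 (pd i b₂) x‖ₑ * ‖pd 0 (pd 0 u₂) x‖ₑ) := by
                gcongr; exact h.enorm_b₂_le x
            _ = _ := by ring
    _ = 2 * e * (∫⁻ x, ‖density b₂ x‖ₑ)
        + 4 * e * ∫⁻ x, ‖pd 0 (pd i b₂) x‖ₑ * ‖pd 0 (pd 0 u₂) x‖ₑ := by
        have := h.e_lt
        rw [lintegral_add_left (cd.measurable.enorm.const_mul _),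
          lintegral_const_mul' _ _ (by finiteness), lintegral_const_mul' _ _ (by finiteness)]
    _ ≤ 2 * e * ((2 * e + 14 * e ^ 2) * e ^ 2) + 4 * e * (e * μ) := by
        gcongr
        · exact h.lintegral_density_le
        · exact (lintegral_mul_le_l2 (c5 0 i) (c6 0 0)).trans
            (mul_le_mul' (h.pd_pd_b₂_le 0 i) (h.pd_pd_u₂_le 0 0))
    _ = _ := by ring

end FixedTimeBounds

/-! ### Energy bounds for smooth solutions -/

theorem volume_restrict_slab (t : ℝ) :
    (volume : Measure (ℝ × Plane)).restrict (slab t)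
      = (volume.restrict (Icc 0 t)).prod (volume : Measure Plane) := by
  rw [slab, Measure.volume_eq_prod, ← Measure.prod_restrict, Measure.restrict_univ]

theorem slab_mono {t T : ℝ} (h : t ≤ T) : slab t ⊆ slab T :=
  prod_mono_left (Icc_subset_Icc_right h)

theorem aemeasurable_slab {t : ℝ} {g : ℝ × Plane → ℝ} (hg : ContinuousOn g (slab t)) :
    AEMeasurable g ((volume.restrict (Icc 0 t)).prod (volume : Measure Plane)) := by
  rw [← volume_restrict_slab]
  exact hg.aemeasurable (measurableSet_slab t)

theorem lintegral_slab {t : ℝ} {g : ℝ × Plane → ℝ≥0∞}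
    (hg : AEMeasurable g ((volume.restrict (Icc 0 t)).prod (volume : Measure Plane))) :
    ∫⁻ p in slab t, g p = ∫⁻ τ in Icc 0 t, ∫⁻ x, g (τ, x) := by
  rw [volume_restrict_slab, lintegral_prod _ hg]

theorem aemeasurable_l2Sq {t : ℝ} {g : ScalarField} (hg : ContinuousOn (joint g) (slab t)) :
    AEMeasurable (fun τ => l2Sq (g τ)) (volume.restrict (Icc 0 t)) :=
  ((aemeasurable_slab hg).enorm.pow_const 2).lintegral_prod_right'

theorem l2_le_rpow {f : Plane → ℝ} {c : ℝ≥0∞} (h : l2Sq f ≤ c) : l2 f ≤ c ^ (1 / 2 : ℝ) :=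
  ENNReal.rpow_le_rpow h (by norm_num)

theorem rpow_half_sq (c : ℝ≥0∞) : (c ^ (1 / 2 : ℝ)) ^ 2 = c := by
  rw [← ENNReal.rpow_two, ← ENNReal.rpow_mul]; simp

theorem l2Sq_le_h2Sq (f : Plane → ℝ) : l2Sq f ≤ h2Sq f := by
  rw [h2Sq, add_assoc]; exact le_self_add

theorem l2Sq_pd_le_h2Sq (f : Plane → ℝ) (i : Fin 2) : l2Sq (pd i f) ≤ h2Sq f :=
  ((Finset.single_le_sum (f := fun i => l2Sq (pd i f)) (fun _ _ => zero_le)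
    (Finset.mem_univ i)).trans le_add_self).trans le_self_add

theorem l2Sq_pd_pd_le_h2Sq (f : Plane → ℝ) (i j : Fin 2) : l2Sq (pd i (pd j f)) ≤ h2Sq f :=
  ((Finset.single_le_sum (f := fun j => l2Sq (pd i (pd j f))) (fun _ _ => zero_le)
    (Finset.mem_univ j)).trans (Finset.single_le_sum
      (f := fun i => ∑ j, l2Sq (pd i (pd j f))) (fun _ _ => zero_le)
    (Finset.mem_univ i))).trans le_add_self

theorem l2Sq_le_h1Sq (f : Plane → ℝ) : l2Sq f ≤ h1Sq f := le_self_add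

theorem l2Sq_pd_le_h1Sq (f : Plane → ℝ) (i : Fin 2) : l2Sq (pd i f) ≤ h1Sq f :=
  (Finset.single_le_sum (f := fun i => l2Sq (pd i f)) (fun _ _ => zero_le)
    (Finset.mem_univ i)).trans le_add_self

theorem h1Sq_pd_le_h2Sq (f : Plane → ℝ) (j : Fin 2) :
    h1Sq (pd j f) ≤ h2Sq f := by
  rw [h1Sq, h2Sq]
  have h1 : l2Sq (pd j f) ≤ l2Sq f + ∑ i, l2Sq (pd i f) :=
    (Finset.single_le_sum (f := fun i => l2Sq (pd i f)) (fun _ _ => zero_le)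
      (Finset.mem_univ j)).trans le_add_self
  have h2 : ∑ i, l2Sq (pd i (pd j f)) ≤ ∑ i, ∑ j, l2Sq (pd i (pd j f)) :=
    Finset.sum_le_sum fun i _ => Finset.single_le_sum (f := fun j => l2Sq (pd i (pd j f)))
      (fun _ _ => zero_le) (Finset.mem_univ j)
  exact add_le_add h1 h2

/-- `‖∂₂b‖²_{H¹}` at time `τ`, the integrand of `E₁`. -/
noncomputable def magneticDissipation (b : VectorField) (τ : ℝ) : ℝ≥0∞ :=
  ∑ k, h1Sq (pd 1 (b k τ))

/-- `‖∇u‖²_{H²}` at time `τ`, the dissipative integrand of `E₀`. -/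
noncomputable def viscousDissipation (u : VectorField) (τ : ℝ) : ℝ≥0∞ :=
  ∑ i, ∑ k, h2Sq (pd i (u k τ))

theorem E₀_mono (u b : VectorField) {s t : ℝ} (h : s ≤ t) : E₀ u b s ≤ E₀ u b t :=
  add_le_add (biSup_mono fun _ hτ => ⟨hτ.1, hτ.2.trans h⟩)
    (lintegral_mono_set (Icc_subset_Icc_right h))

theorem sum_h2Sq_le_E₀ (u b : VectorField) {t τ : ℝ} (hτ : τ ∈ Icc 0 t) :
    (∑ k, h2Sq (u k τ)) + ∑ k, h2Sq (b k τ) ≤ E₀ u b t :=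
  (le_biSup (fun τ => (∑ k, h2Sq (u k τ)) + ∑ k, h2Sq (b k τ)) hτ).trans le_self_add

theorem h2Sq_u_le_E₀ (u b : VectorField) {t τ : ℝ} (hτ : τ ∈ Icc 0 t) (k : Fin 2) :
    h2Sq (u k τ) ≤ E₀ u b t :=
  ((Finset.single_le_sum (f := fun k => h2Sq (u k τ)) (fun _ _ => zero_le)
    (Finset.mem_univ k)).trans le_self_add).trans (sum_h2Sq_le_E₀ u b hτ)

theorem h2Sq_b_le_E₀ (u b : VectorField) {t τ : ℝ} (hτ : τ ∈ Icc 0 t) (k : Fin 2) :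
    h2Sq (b k τ) ≤ E₀ u b t :=
  ((Finset.single_le_sum (f := fun k => h2Sq (b k τ)) (fun _ _ => zero_le)
    (Finset.mem_univ k)).trans le_add_self).trans (sum_h2Sq_le_E₀ u b hτ)

theorem lintegral_viscousDissipation_le (u b : VectorField) (t : ℝ) :
    ∫⁻ τ in Icc 0 t, viscousDissipation u τ ≤ E₀ u b t := le_add_self

theorem magneticDissipation_le (u b : VectorField) {t τ : ℝ} (hτ : τ ∈ Icc 0 t) :
    magneticDissipation b τ ≤ E₀ u b t :=
  ((Finset.sum_le_sum fun k _ => h1Sq_pd_le_h2Sq (b k τ) 1).trans le_add_self).trans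
    (sum_h2Sq_le_E₀ u b hτ)

namespace IsSmoothSolution

variable {T : ℝ} {u b : VectorField} {P : ScalarField}

theorem contDiff_u (h : IsSmoothSolution T u b P) {τ : ℝ} (hτ : τ ∈ Icc 0 T) (k : Fin 2) :
    ContDiff ℝ 3 (u k τ) := contDiff_slice (g := u k) (h.u_smooth k) hτ

theorem contDiff_b (h : IsSmoothSolution T u b P) {τ : ℝ} (hτ : τ ∈ Icc 0 T) (k : Fin 2) :
    ContDiff ℝ 3 (b k τ) := contDiff_slice (g := b k) (h.b_smooth k) hτ

theorem E₀_lt (h : IsSmoothSolution T u b P) {t : ℝ} (ht : t ≤ T) : E₀ u b t < ∞ :=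
  (E₀_mono u b ht).trans_lt h.finite_energy

theorem magneticBounds (h : IsSmoothSolution T u b P) {t τ : ℝ} (ht : t ≤ T) (hτ : τ ∈ Icc 0 t) :
    MagneticBounds (b 0 τ) (b 1 τ) (E₀ u b t ^ (1 / 2 : ℝ))
      (magneticDissipation b τ ^ (1 / 2 : ℝ)) := by
  have hk : ∀ k, h1Sq (pd 1 (b k τ)) ≤ magneticDissipation b τ := fun k =>
    Finset.single_le_sum (f := fun k => h1Sq (pd 1 (b k τ))) (fun _ _ => zero_le)
      (Finset.mem_univ k)
  have hE := h2Sq_b_le_E₀ u b hτ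
  have hτT : τ ∈ Icc 0 T := ⟨hτ.1, hτ.2.trans ht⟩
  exact
    { b₁_smooth := h.contDiff_b hτT 0
      b₂_smooth := h.contDiff_b hτT 1
      e_lt := ENNReal.rpow_lt_top_of_nonneg (by norm_num) (h.E₀_lt ht).ne
      β_le := ENNReal.rpow_le_rpow (magneticDissipation_le u b hτ) (by norm_num)
      b₁_le := l2_le_rpow ((l2Sq_le_h2Sq _).trans (hE 0))
      b₂_le := l2_le_rpow ((l2Sq_le_h2Sq _).trans (hE 1))
      pd_b₁_le := fun i => l2_le_rpow ((l2Sq_pd_le_h2Sq _ i).trans (hE 0))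
      pd_b₂_le := fun i => l2_le_rpow ((l2Sq_pd_le_h2Sq _ i).trans (hE 1))
      pd_pd_b₂_le := fun i j => l2_le_rpow ((l2Sq_pd_pd_le_h2Sq _ i j).trans (hE 1))
      pd1_b₁_le := l2_le_rpow ((l2Sq_le_h1Sq _).trans (hk 0))
      pd1_b₂_le := l2_le_rpow ((l2Sq_le_h1Sq _).trans (hk 1))
      pd_pd1_b₁_le := fun i => l2_le_rpow ((l2Sq_pd_le_h1Sq _ i).trans (hk 0))
      pd_pd1_b₂_le := fun i => l2_le_rpow ((l2Sq_pd_le_h1Sq _ i).trans (hk 1)) }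

theorem fixedTimeBounds (h : IsSmoothSolution T u b P) {t τ : ℝ} (ht : t ≤ T) (hτ : τ ∈ Icc 0 t)
    (hfin : viscousDissipation u τ < ∞) :
    FixedTimeBounds (u 1 τ) (b 0 τ) (b 1 τ) (E₀ u b t ^ (1 / 2 : ℝ))
      (magneticDissipation b τ ^ (1 / 2 : ℝ)) (viscousDissipation u τ ^ (1 / 2 : ℝ)) := by
  have hk : ∀ i, h2Sq (pd i (u 1 τ)) ≤ viscousDissipation u τ := fun i =>
    (Finset.single_le_sum (f := fun k => h2Sq (pd i (u k τ))) (fun _ _ => zero_le)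
      (Finset.mem_univ 1)).trans (Finset.single_le_sum
        (f := fun i => ∑ k, h2Sq (pd i (u k τ))) (fun _ _ => zero_le) (Finset.mem_univ i))
  exact
    { toMagneticBounds := h.magneticBounds ht hτ
      u₂_smooth := h.contDiff_u ⟨hτ.1, hτ.2.trans ht⟩ 1
      μ_lt := ENNReal.rpow_lt_top_of_nonneg (by norm_num) hfin.ne
      pd_u₂_le := fun i => l2_le_rpow ((l2Sq_le_h2Sq _).trans (hk i))
      pd_pd_u₂_le := fun i j => l2_le_rpow ((l2Sq_pd_le_h2Sq _ i).trans (hk j))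
      pd_pd_pd_u₂_le := fun i j k => l2_le_rpow ((l2Sq_pd_pd_le_h2Sq _ i j).trans (hk k)) }

theorem enorm_u_le (h : IsSmoothSolution T u b P) {t τ : ℝ} (ht : t ≤ T) (hτ : τ ∈ Icc 0 t)
    (k : Fin 2) (x : Plane) : ‖u k τ x‖ₑ ≤ 2 * E₀ u b t ^ (1 / 2 : ℝ) := by
  have hE := h2Sq_u_le_E₀ u b hτ k
  have hfin : E₀ u b t ^ (1 / 2 : ℝ) < ∞ :=
    ENNReal.rpow_lt_top_of_nonneg (by norm_num) (h.E₀_lt ht).ne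
  exact le_two_mul_of_sq (enorm_sq_le_of_l2
    ((h.contDiff_u ⟨hτ.1, hτ.2.trans ht⟩ k).of_le (by norm_num)) hfin hfin
    (l2_le_rpow ((l2Sq_le_h2Sq _).trans hE)) (l2_le_rpow ((l2Sq_pd_le_h2Sq _ 0).trans hE))
    (l2_le_rpow ((l2Sq_pd_le_h2Sq _ 1).trans hE))
    (l2_le_rpow ((l2Sq_pd_pd_le_h2Sq _ 0 1).trans hE)) x)

theorem contDiffOn_spd_u (h : IsSmoothSolution T u b P) (hT : 0 < T) (k i : Fin 2) :
    ContDiffOn ℝ 2 (joint (spd i (u k))) (slab T) :=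
  contDiffOn_spd (n := 2) hT (h.u_smooth k) i

theorem contDiffOn_spd_b (h : IsSmoothSolution T u b P) (hT : 0 < T) (k i : Fin 2) :
    ContDiffOn ℝ 2 (joint (spd i (b k))) (slab T) :=
  contDiffOn_spd (n := 2) hT (h.b_smooth k) i

theorem contDiffOn_spd_spd_u (h : IsSmoothSolution T u b P) (hT : 0 < T) (k i j : Fin 2) :
    ContDiffOn ℝ 1 (joint (spd i (spd j (u k)))) (slab T) :=
  contDiffOn_spd (n := 1) hT (h.contDiffOn_spd_u hT k j) i

theorem contDiffOn_spd_spd_b (h : IsSmoothSolution T u b P) (hT : 0 < T) (k i j : Fin 2) :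
    ContDiffOn ℝ 1 (joint (spd i (spd j (b k)))) (slab T) :=
  contDiffOn_spd (n := 1) hT (h.contDiffOn_spd_b hT k j) i

theorem continuousOn_spd_spd_spd_u (h : IsSmoothSolution T u b P) (hT : 0 < T) (k i j l : Fin 2) :
    ContinuousOn (joint (spd i (spd j (spd l (u k))))) (slab T) :=
  (contDiffOn_spd (n := 0) hT (h.contDiffOn_spd_spd_u hT k j l) i).continuousOn

theorem aemeasurable_viscousDissipation (h : IsSmoothSolution T u b P) (hT : 0 < T) {t : ℝ}
    (ht : t ≤ T) : AEMeasurable (viscousDissipation u) (volume.restrict (Icc 0 t)) := by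
  have hm := slab_mono ht
  refine Finset.aemeasurable_fun_sum _ fun i _ => Finset.aemeasurable_fun_sum _ fun k _ => ?_
  refine ((aemeasurable_l2Sq (g := spd i (u k)) ?_).add
    (Finset.aemeasurable_fun_sum _ fun j _ => aemeasurable_l2Sq (g := spd j (spd i (u k))) ?_)).add
    (Finset.aemeasurable_fun_sum _ fun j _ => Finset.aemeasurable_fun_sum _ fun l _ =>
      aemeasurable_l2Sq (g := spd j (spd l (spd i (u k)))) ?_)
  · exact (h.contDiffOn_spd_u hT k i).continuousOn.mono hm
  · exact (h.contDiffOn_spd_spd_u hT k j i).continuousOn.mono hm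
  · exact (h.continuousOn_spd_spd_spd_u hT k j l i).mono hm

theorem ae_fixedTimeBounds (h : IsSmoothSolution T u b P) (hT : 0 < T) {t : ℝ} (ht : t ≤ T) :
    ∀ᵐ τ ∂(volume.restrict (Icc 0 t)), τ ∈ Icc 0 t ∧
      FixedTimeBounds (u 1 τ) (b 0 τ) (b 1 τ) (E₀ u b t ^ (1 / 2 : ℝ))
        (magneticDissipation b τ ^ (1 / 2 : ℝ)) (viscousDissipation u τ ^ (1 / 2 : ℝ)) := by
  have hfin : ∫⁻ τ in Icc 0 t, viscousDissipation u τ ≠ ∞ :=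
    ((lintegral_viscousDissipation_le u b t).trans_lt (h.E₀_lt ht)).ne
  filter_upwards [ae_lt_top' (h.aemeasurable_viscousDissipation hT ht) hfin,
    ae_restrict_mem measurableSet_Icc] with τ h1 h2
  exact ⟨h2, h.fixedTimeBounds ht h2 h1⟩

end IsSmoothSolution

theorem rpow_half_le_one_add (c : ℝ≥0∞) : c ^ (1 / 2 : ℝ) ≤ 1 + c := by
  rcases le_total c 1 with h | h
  · exact (ENNReal.rpow_le_one h (by norm_num)).trans le_self_add
  · exact ((ENNReal.rpow_le_rpow_of_exponent_le h (by norm_num)).trans_eq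
      (ENNReal.rpow_one c)).trans le_add_self

theorem rpow_half_mul_rpow_half_le (c d : ℝ≥0∞) : c ^ (1 / 2 : ℝ) * d ^ (1 / 2 : ℝ) ≤ d + c := by
  rcases le_total c d with h | h
  · calc c ^ (1 / 2 : ℝ) * d ^ (1 / 2 : ℝ) ≤ (d ^ (1 / 2 : ℝ)) ^ 2 := by
          rw [sq]; gcongr
      _ ≤ d + c := by rw [rpow_half_sq]; exact le_self_add
  · calc c ^ (1 / 2 : ℝ) * d ^ (1 / 2 : ℝ) ≤ (c ^ (1 / 2 : ℝ)) ^ 2 := by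
          rw [sq]; gcongr
      _ ≤ d + c := by rw [rpow_half_sq]; exact le_add_self

/-- A spatial integral which is bounded by a multiple of `1 + ‖∇u‖²_{H²}` at almost every time is
finite in space-time. -/
theorem lintegral_lt_top_of_ae_le {u b : VectorField} {t : ℝ} (hE : E₀ u b t < ∞)
    {G : ℝ → ℝ≥0∞} {K : ℝ≥0∞} (hK : K < ∞)
    (hle : ∀ᵐ τ ∂(volume.restrict (Icc 0 t)), G τ ≤ K * (1 + viscousDissipation u τ)) :
    ∫⁻ τ in Icc 0 t, G τ < ∞ := by
  refine (lintegral_mono_ae hle).trans_lt ?_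
  rw [lintegral_const_mul' _ _ hK.ne, lintegral_add_left measurable_const]
  refine ENNReal.mul_lt_top hK (ENNReal.add_lt_top.2 ⟨?_, ?_⟩)
  · simp
  · exact (lintegral_viscousDissipation_le u b t).trans_lt hE

theorem integrableOn_slab {u b : VectorField} {t : ℝ} (hE : E₀ u b t < ∞)
    {g : ℝ × Plane → ℝ} (hg : ContinuousOn g (slab t)) {K : ℝ≥0∞} (hK : K < ∞)
    (hle : ∀ᵐ τ ∂(volume.restrict (Icc 0 t)),
      ∫⁻ x, ‖g (τ, x)‖ₑ ≤ K * (1 + viscousDissipation u τ)) : IntegrableOn g (slab t) := by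
  refine ⟨hg.aestronglyMeasurable (measurableSet_slab t), ?_⟩
  rw [HasFiniteIntegral, lintegral_slab (aemeasurable_slab hg).enorm]
  exact lintegral_lt_top_of_ae_le hE hK hle

/-! ### Integration in space-time -/

namespace IsSmoothSolution

variable {T : ℝ} {u b : VectorField} {P : ScalarField}

theorem E₁_lt (h : IsSmoothSolution T u b P) {t : ℝ} (ht : t ≤ T) : E₁ b t < ∞ := by
  calc E₁ b t ≤ ∫⁻ _ in Icc 0 t, E₀ u b t :=
        setLIntegral_mono measurable_const fun τ hτ => magneticDissipation_le u b hτ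
    _ < ∞ := by
        rw [setLIntegral_const]
        exact ENNReal.mul_lt_top (h.E₀_lt ht) (by simp)

theorem e_lt (h : IsSmoothSolution T u b P) {t : ℝ} (ht : t ≤ T) :
    E₀ u b t ^ (1 / 2 : ℝ) < ∞ :=
  ENNReal.rpow_lt_top_of_nonneg (by norm_num) (h.E₀_lt ht).ne

theorem lintegral_omega_lt (h : IsSmoothSolution T u b P) {t : ℝ} (ht : t ≤ T) {ω : ScalarField}
    (hω : ∀ τ x, ‖ω τ x‖ₑ ≤ ‖u 0 τ x‖ₑ + ‖b 0 τ x‖ₑ) :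
    ∫⁻ τ in Icc 0 t, ∫⁻ x, ‖ω τ x‖ₑ ^ 2 * ‖pd 0 (pd 0 (b 1 τ)) x‖ₑ ^ 2 < ∞ := by
  have he := h.e_lt ht
  set e := E₀ u b t ^ (1 / 2 : ℝ) with hedef
  refine lintegral_lt_top_of_ae_le (h.E₀_lt ht) (K := (2 * e + 2 * e) ^ 2 * e ^ 2)
    (by finiteness) ?_
  filter_upwards [ae_restrict_mem measurableSet_Icc] with τ hτ
  have hM := h.magneticBounds ht hτ
  calc ∫⁻ x, ‖ω τ x‖ₑ ^ 2 * ‖pd 0 (pd 0 (b 1 τ)) x‖ₑ ^ 2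
      ≤ ∫⁻ x, (2 * e + 2 * e) ^ 2 * ‖pd 0 (pd 0 (b 1 τ)) x‖ₑ ^ 2 := by
        refine lintegral_mono fun x => ?_
        gcongr
        exact (hω τ x).trans (add_le_add (h.enorm_u_le ht hτ 0 x) (hM.enorm_b₁_le x))
    _ = (2 * e + 2 * e) ^ 2 * l2 (pd 0 (pd 0 (b 1 τ))) ^ 2 := by
        rw [lintegral_const_mul' _ _ (by finiteness), l2_sq, l2Sq]
    _ ≤ (2 * e + 2 * e) ^ 2 * e ^ 2 := by gcongr; exact hM.pd_pd_b₂_le 0 0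
    _ ≤ (2 * e + 2 * e) ^ 2 * e ^ 2 * (1 + viscousDissipation u τ) :=
        le_mul_of_one_le_right zero_le le_self_add

theorem APlus_lt (h : IsSmoothSolution T u b P) {t : ℝ} (ht : t ≤ T) : APlus u b t < ∞ :=
  h.lintegral_omega_lt ht fun _ _ => enorm_add_le _ _

theorem AMinus_lt (h : IsSmoothSolution T u b P) {t : ℝ} (ht : t ≤ T) : AMinus u b t < ∞ :=
  h.lintegral_omega_lt ht fun _ _ => enorm_sub_le

theorem continuousOn_u (h : IsSmoothSolution T u b P) {t : ℝ} (ht : t ≤ T) (k : Fin 2) :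
    ContinuousOn (fun p : ℝ × Plane => u k p.1 p.2) (slab t) :=
  (h.u_smooth k).continuousOn.mono (slab_mono ht)

theorem continuousOn_b (h : IsSmoothSolution T u b P) {t : ℝ} (ht : t ≤ T) (k : Fin 2) :
    ContinuousOn (fun p : ℝ × Plane => b k p.1 p.2) (slab t) :=
  (h.b_smooth k).continuousOn.mono (slab_mono ht)

theorem continuousOn_pd_u (h : IsSmoothSolution T u b P) (hT : 0 < T) {t : ℝ} (ht : t ≤ T)
    (k i : Fin 2) : ContinuousOn (fun p : ℝ × Plane => pd i (u k p.1) p.2) (slab t) :=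
  (h.contDiffOn_spd_u hT k i).continuousOn.mono (slab_mono ht)

theorem continuousOn_pd_b (h : IsSmoothSolution T u b P) (hT : 0 < T) {t : ℝ} (ht : t ≤ T)
    (k i : Fin 2) : ContinuousOn (fun p : ℝ × Plane => pd i (b k p.1) p.2) (slab t) :=
  (h.contDiffOn_spd_b hT k i).continuousOn.mono (slab_mono ht)

theorem continuousOn_pd_pd_u (h : IsSmoothSolution T u b P) (hT : 0 < T) {t : ℝ} (ht : t ≤ T)
    (k i j : Fin 2) :
    ContinuousOn (fun p : ℝ × Plane => pd i (pd j (u k p.1)) p.2) (slab t) :=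
  (h.contDiffOn_spd_spd_u hT k i j).continuousOn.mono (slab_mono ht)

theorem continuousOn_pd_pd_b (h : IsSmoothSolution T u b P) (hT : 0 < T) {t : ℝ} (ht : t ≤ T)
    (k i j : Fin 2) :
    ContinuousOn (fun p : ℝ × Plane => pd i (pd j (b k p.1)) p.2) (slab t) :=
  (h.contDiffOn_spd_spd_b hT k i j).continuousOn.mono (slab_mono ht)

theorem continuousOn_pd_pd_pd_u (h : IsSmoothSolution T u b P) (hT : 0 < T) {t : ℝ} (ht : t ≤ T)
    (k i j l : Fin 2) :
    ContinuousOn (fun p : ℝ × Plane => pd i (pd j (pd l (u k p.1))) p.2) (slab t) :=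
  (h.continuousOn_spd_spd_spd_u hT k i j l).mono (slab_mono ht)

/-- The contribution of `b₁ ∂₁u₂ (∂₁²b₂)²`, estimated with `2 b₁ = Ω₊ - Ω₋`. -/
theorem lintegral_b₁_term_le (h : IsSmoothSolution T u b P) (hT : 0 < T) {t : ℝ} (ht : t ≤ T) :
    ∫⁻ p in slab t, ‖b 0 p.1 p.2 * pd 0 (u 1 p.1) p.2 * pd 0 (pd 0 (b 1 p.1)) p.2 ^ 2‖ₑ
      ≤ 2 * E₀ u b t * (APlus u b t + AMinus u b t) ^ (1 / 2 : ℝ) := by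
  have cb := h.continuousOn_b ht 0
  have cu := h.continuousOn_u ht 0
  have cw := h.continuousOn_pd_pd_b hT ht 1 0 0
  have cv := h.continuousOn_pd_u hT ht 1 0
  have mb := aemeasurable_slab (cb.fun_mul cw)
  have mv := aemeasurable_slab (cv.fun_mul cw)
  have mp : AEMeasurable (fun p : ℝ × Plane => ‖omegaPlus u b p.1 p.2‖ₑ ^ 2
      * ‖pd 0 (pd 0 (b 1 p.1)) p.2‖ₑ ^ 2) ((volume.restrict (Icc 0 t)).prod volume) :=
    ((aemeasurable_slab (cu.add cb)).enorm.pow_const 2).mul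
      ((aemeasurable_slab cw).enorm.pow_const 2)
  have mm : AEMeasurable (fun p : ℝ × Plane => ‖omegaMinus u b p.1 p.2‖ₑ ^ 2
      * ‖pd 0 (pd 0 (b 1 p.1)) p.2‖ₑ ^ 2) ((volume.restrict (Icc 0 t)).prod volume) :=
    ((aemeasurable_slab (cu.sub cb)).enorm.pow_const 2).mul
      ((aemeasurable_slab cw).enorm.pow_const 2)
  have h1 : ∫⁻ p in slab t, ‖b 0 p.1 p.2 * pd 0 (pd 0 (b 1 p.1)) p.2‖ₑ ^ 2
      ≤ APlus u b t + AMinus u b t := by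
    have hp : APlus u b t = _ := (lintegral_slab mp).symm
    have hm : AMinus u b t = _ := (lintegral_slab mm).symm
    rw [hp, hm, ← lintegral_add_left' (by rwa [volume_restrict_slab])]
    refine lintegral_mono fun p => ?_
    simp only [enorm_mul, mul_pow, ← add_mul]
    gcongr
    simp only [omegaPlus, omegaMinus, ← enorm_pow]
    rw [Real.enorm_of_nonneg (sq_nonneg _), Real.enorm_of_nonneg (sq_nonneg _),
      Real.enorm_of_nonneg (sq_nonneg _), ← ENNReal.ofReal_add (sq_nonneg _) (sq_nonneg _)]
    refine ENNReal.ofReal_le_ofReal ?_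
    nlinarith [sq_nonneg (u 0 p.1 p.2), sq_nonneg (b 0 p.1 p.2)]
  have h2 : ∫⁻ p in slab t, ‖pd 0 (u 1 p.1) p.2 * pd 0 (pd 0 (b 1 p.1)) p.2‖ₑ ^ 2
      ≤ (2 * E₀ u b t) ^ 2 := by
    rw [lintegral_slab (mv.enorm.pow_const 2)]
    calc ∫⁻ τ in Icc 0 t, ∫⁻ x, ‖pd 0 (u 1 τ) x * pd 0 (pd 0 (b 1 τ)) x‖ₑ ^ 2
        ≤ ∫⁻ τ in Icc 0 t, 4 * E₀ u b t * viscousDissipation u τ := by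
          refine lintegral_mono_ae ?_
          filter_upwards [h.ae_fixedTimeBounds hT ht] with τ hτ
          have := hτ.2.l2Sq_pd0_u₂_mul_le
          rwa [rpow_half_sq, rpow_half_sq] at this
      _ = 4 * E₀ u b t * ∫⁻ τ in Icc 0 t, viscousDissipation u τ :=
          lintegral_const_mul' _ _ (ENNReal.mul_ne_top (by simp) (h.E₀_lt ht).ne)
      _ ≤ 4 * E₀ u b t * E₀ u b t := by gcongr; exact lintegral_viscousDissipation_le u b t
      _ = _ := by ring
  calc _ = ∫⁻ p in slab t, ‖b 0 p.1 p.2 * pd 0 (pd 0 (b 1 p.1)) p.2‖ₑ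
          * ‖pd 0 (u 1 p.1) p.2 * pd 0 (pd 0 (b 1 p.1)) p.2‖ₑ := by
        refine lintegral_congr fun p => ?_
        rw [← enorm_mul]
        congr 1
        ring
    _ ≤ (APlus u b t + AMinus u b t) ^ (1 / 2 : ℝ) * ((2 * E₀ u b t) ^ 2) ^ (1 / 2 : ℝ) := by
        rw [← volume_restrict_slab] at mb mv
        refine (lintegral_enorm_mul_le _ mb mv).trans ?_
        gcongr
    _ = _ := by
        rw [← ENNReal.rpow_two, ← ENNReal.rpow_mul]
        norm_num
        ring

theorem continuousOn_remainder (h : IsSmoothSolution T u b P) (hT : 0 < T) {t : ℝ} (ht : t ≤ T) :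
    ContinuousOn (fun p : ℝ × Plane => remainder (u 1 p.1) (b 0 p.1) (b 1 p.1) p.2) (slab t) := by
  have cb := h.continuousOn_b ht
  have cpb := h.continuousOn_pd_b hT ht 1
  have cppb := h.continuousOn_pd_pd_b hT ht 1
  have cpu := h.continuousOn_pd_u hT ht 1
  have cppu := h.continuousOn_pd_pd_u hT ht 1
  have cpppu := h.continuousOn_pd_pd_pd_u hT ht 1
  unfold remainder nonlinSource
  fun_prop

theorem lintegral_remainder_le (h : IsSmoothSolution T u b P) (hT : 0 < T) {t : ℝ} (ht : t ≤ T) :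
    ∫⁻ p in slab t, ‖remainder (u 1 p.1) (b 0 p.1) (b 1 p.1) p.2‖ₑ
      ≤ 1000 * (E₀ u b t ^ (1 / 2 : ℝ) + (E₀ u b t ^ (1 / 2 : ℝ)) ^ 2
          + (E₀ u b t ^ (1 / 2 : ℝ)) ^ 3) * (E₀ u b t + E₁ b t) := by
  have he := h.e_lt ht
  set e := E₀ u b t ^ (1 / 2 : ℝ) with hedef
  rw [lintegral_slab (aemeasurable_slab (h.continuousOn_remainder hT ht)).enorm]
  calc _ ≤ ∫⁻ τ in Icc 0 t, 1000 * (e + e ^ 2 + e ^ 3)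
          * (viscousDissipation u τ + magneticDissipation b τ) := by
        refine lintegral_mono_ae ?_
        filter_upwards [h.ae_fixedTimeBounds hT ht] with τ hτ
        refine hτ.2.lintegral_remainder_le.trans ?_
        gcongr
        exact rpow_half_mul_rpow_half_le _ _
    _ = 1000 * (e + e ^ 2 + e ^ 3) * ((∫⁻ τ in Icc 0 t, viscousDissipation u τ)
          + ∫⁻ τ in Icc 0 t, magneticDissipation b τ) := by
        rw [lintegral_const_mul' _ _ (by finiteness),
          lintegral_add_left' (h.aemeasurable_viscousDissipation hT ht)]
    _ ≤ _ := by
        gcongr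
        · exact lintegral_viscousDissipation_le u b t
        · exact le_rfl

theorem integrableOn_remainder (h : IsSmoothSolution T u b P) (hT : 0 < T) {t : ℝ} (ht : t ≤ T) :
    IntegrableOn (fun p : ℝ × Plane => remainder (u 1 p.1) (b 0 p.1) (b 1 p.1) p.2) (slab t) := by
  have he := h.e_lt ht
  have h0 := h.E₀_lt ht
  have h1 := h.E₁_lt ht
  refine ⟨(h.continuousOn_remainder hT ht).aestronglyMeasurable (measurableSet_slab t), ?_⟩
  exact (h.lintegral_remainder_le hT ht).trans_lt (by finiteness)

theorem integrableOn_b₁_term (h : IsSmoothSolution T u b P) (hT : 0 < T) {t : ℝ} (ht : t ≤ T) :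
    IntegrableOn (fun p : ℝ × Plane =>
      b 0 p.1 p.2 * pd 0 (u 1 p.1) p.2 * pd 0 (pd 0 (b 1 p.1)) p.2 ^ 2) (slab t) := by
  have h0 := h.E₀_lt ht
  have hA : (APlus u b t + AMinus u b t) ^ (1 / 2 : ℝ) < ∞ :=
    ENNReal.rpow_lt_top_of_nonneg (by norm_num)
      (ENNReal.add_lt_top.2 ⟨h.APlus_lt ht, h.AMinus_lt ht⟩).ne
  have cb := h.continuousOn_b ht
  have cppb := h.continuousOn_pd_pd_b hT ht 1
  have cpu := h.continuousOn_pd_u hT ht 1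
  refine ⟨ContinuousOn.aestronglyMeasurable (by fun_prop) (measurableSet_slab t), ?_⟩
  exact (h.lintegral_b₁_term_le hT ht).trans_lt (by finiteness)

theorem integrableOn_main (h : IsSmoothSolution T u b P) (hT : 0 < T) {t : ℝ} (ht : t ≤ T) :
    IntegrableOn (fun p : ℝ × Plane =>
      pd 1 (u 1 p.1) p.2 * pd 0 (pd 0 (b 1 p.1)) p.2 ^ 2) (slab t) := by
  have he := h.e_lt ht
  have cppb := h.continuousOn_pd_pd_b hT ht 1
  have cpu := h.continuousOn_pd_u hT ht 1
  refine integrableOn_slab (h.E₀_lt ht) (K := 2 * (E₀ u b t ^ (1 / 2 : ℝ)) ^ 2) (by fun_prop)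
    (by finiteness) ?_
  filter_upwards [h.ae_fixedTimeBounds hT ht] with τ hτ
  refine hτ.2.lintegral_pd1_u₂_mul_le.trans ?_
  calc _ = 2 * (E₀ u b t ^ (1 / 2 : ℝ)) ^ 2 * viscousDissipation u τ ^ (1 / 2 : ℝ) := by ring
    _ ≤ _ := by gcongr; exact rpow_half_le_one_add _

/-- The components of the flux are integrable in space-time. The parameters `v`, `i`, `c` cover
`flux₁` and `flux₂` simultaneously. -/
theorem integrableOn_flux (h : IsSmoothSolution T u b P) (hT : 0 < T) {t : ℝ} (ht : t ≤ T)
    (k i : Fin 2) {c : ℝ} (hc : ‖c‖ₑ = 2) :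
    IntegrableOn (fun p : ℝ × Plane => u k p.1 p.2 * density (b 1 p.1) p.2
      + c * (b 1 p.1 p.2 * pd 0 (pd i (b 1 p.1)) p.2 * pd 0 (pd 0 (u 1 p.1)) p.2)) (slab t) := by
  have he := h.e_lt ht
  set e := E₀ u b t ^ (1 / 2 : ℝ) with hedef
  have cb := h.continuousOn_b ht 1
  have cu := h.continuousOn_u ht k
  have cppb := h.continuousOn_pd_pd_b hT ht 1
  have cppu := h.continuousOn_pd_pd_u hT ht 1
  refine integrableOn_slab (h.E₀_lt ht)
    (K := 2 * e * ((2 * e + 14 * e ^ 2) * e ^ 2) + 4 * e ^ 2)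
    (by unfold density; fun_prop) (by finiteness) ?_
  filter_upwards [h.ae_fixedTimeBounds hT ht] with τ hτ
  refine (hτ.2.lintegral_flux_le (h.enorm_u_le ht hτ.1 k) i hc).trans ?_
  exact (add_le_add (le_mul_of_one_le_right zero_le le_self_add)
    (mul_le_mul' le_rfl (rpow_half_le_one_add _))).trans_eq (add_mul _ _ _).symm

theorem lintegral_density_le (h : IsSmoothSolution T u b P) {t τ : ℝ} (ht : t ≤ T)
    (hτ : τ ∈ Icc 0 t) : ∫⁻ x, ‖density (b 1 τ) x‖ₑ
      ≤ (2 * E₀ u b t ^ (1 / 2 : ℝ) + 14 * (E₀ u b t ^ (1 / 2 : ℝ)) ^ 2) * E₀ u b t := by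
  have := (h.magneticBounds ht hτ).lintegral_density_le
  rwa [rpow_half_sq] at this ⊢

theorem integrable_density (h : IsSmoothSolution T u b P) {t τ : ℝ} (ht : t ≤ T)
    (hτ : τ ∈ Icc 0 t) : Integrable (density (b 1 τ)) := by
  have h0 := h.E₀_lt ht
  have he := h.e_lt ht
  have hb := h.contDiff_b ⟨hτ.1, hτ.2.trans ht⟩ 1
  have cw : Continuous (pd 0 (pd 0 (b 1 τ))) :=
    continuous_pd ((contDiff_pd (n := 2) hb 0).of_le (by norm_num)) 0
  have cb := hb.continuous
  refine ⟨Continuous.aestronglyMeasurable (by unfold density; fun_prop), ?_⟩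
  exact (h.lintegral_density_le ht hτ).trans_lt (by finiteness)

/-- The space-time balance law for `density`. -/
theorem integral_density_balance (h : IsSmoothSolution T u b P) (hT : 0 < T) {t : ℝ}
    (ht : t ∈ Icc 0 T) :
    ∫ p in slab t, (pd 1 (u 1 p.1) p.2 * pd 0 (pd 0 (b 1 p.1)) p.2 ^ 2
        + b 0 p.1 p.2 * pd 0 (u 1 p.1) p.2 * pd 0 (pd 0 (b 1 p.1)) p.2 ^ 2
        + remainder (u 1 p.1) (b 0 p.1) (b 1 p.1) p.2)
      = (∫ x, density (b 1 t) x) - ∫ x, density (b 1 0) x := by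
  have le13 : (1 : WithTop ℕ∞) ≤ 3 := by norm_num
  have sb : ContDiffOn ℝ 1 (joint (b 1)) (slab T) := (h.b_smooth 1).of_le le13
  have su : ∀ k, ContDiffOn ℝ 1 (joint (u k)) (slab T) := fun k => (h.u_smooth k).of_le le13
  have sppb : ∀ i, ContDiffOn ℝ 1 (joint (spd 0 (spd i (b 1)))) (slab T) :=
    fun i => h.contDiffOn_spd_spd_b hT 1 0 i
  have sppu := h.contDiffOn_spd_spd_u hT 1 0 0
  have sf : ContDiffOn ℝ 1 (joint fun τ => density (b 1 τ)) (slab T) :=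
    (sb.sub (contDiffOn_const.mul (sb.pow 2))).mul ((sppb 0).pow 2)
  have s1 : ContDiffOn ℝ 1 (joint fun τ => flux₁ (u 0 τ) (u 1 τ) (b 1 τ)) (slab T) :=
    ((su 0).mul sf).add (contDiffOn_const.mul ((sb.mul (sppb 1)).mul sppu))
  have s2 : ContDiffOn ℝ 1 (joint fun τ => flux₂ (u 1 τ) (b 1 τ)) (slab T) :=
    ((su 1).mul sf).sub (contDiffOn_const.mul ((sb.mul (sppb 0)).mul sppu))
  have hm := slab_mono ht.2
  have hIoo : ∀ p ∈ Ioo 0 t ×ˢ (univ : Set Plane), p.1 ∈ Ioo 0 T :=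
    fun p hp => ⟨hp.1.1, hp.1.2.trans_le ht.2⟩
  refine integral_balance (f := joint fun τ => density (b 1 τ))
    (V₁ := joint fun τ => flux₁ (u 0 τ) (u 1 τ) (b 1 τ))
    (V₂ := joint fun τ => flux₂ (u 1 τ) (b 1 τ)) ht.1
    (sf.continuousOn.mono hm) (s1.continuousOn.mono hm) (s2.continuousOn.mono hm)
    (fun p hp => differentiableAt_joint sf (hIoo p hp) p.2)
    (fun p hp => differentiableAt_joint s1 (hIoo p hp) p.2)
    (fun p hp => differentiableAt_joint s2 (hIoo p hp) p.2) ?_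
    (h.integrableOn_flux hT ht.2 0 1 enorm_two) ?_
    (((h.integrableOn_main hT ht.2).add (h.integrableOn_b₁_term hT ht.2)).add
      (h.integrableOn_remainder hT ht.2))
    (h.integrable_density ht.2 ⟨ht.1, le_rfl⟩) (h.integrable_density ht.2 ⟨le_rfl, ht.1⟩)
  · rintro ⟨τ, x⟩ hp
    have hτ : τ ∈ Ioo 0 T := hIoo _ hp
    have hτc : τ ∈ Icc 0 T := Ioo_subset_Icc_self hτ
    have db := differentiableAt_joint sb hτ x
    have dw := differentiableAt_joint (sppb 0) hτ x
    have hbt : ∀ y, deriv (fun s => b 1 s y) τ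
        = inductionRHS (u 0 τ) (u 1 τ) (b 0 τ) (b 1 τ) y := fun y => by
      have := h.induction 1 τ hτ y
      simp only [advect, Fin.sum_univ_two] at this
      rw [inductionRHS]
      linarith
    have hwt : deriv (fun s => spd 0 (spd 0 (b 1)) s x) τ
        = pd 0 (pd 0 (inductionRHS (u 0 τ) (u 1 τ) (b 0 τ) (b 1 τ))) x := by
      rw [deriv_spd (h.contDiffOn_spd_b hT 1 0) hτ]
      congr 1
      funext y
      rw [deriv_spd ((h.b_smooth 1).of_le (by norm_num)) hτ]
      congr 1
      exact funext hbt
    have key := density_balance (h.contDiff_u hτc 0) (h.contDiff_u hτc 1) (h.contDiff_b hτc 0)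
      (h.contDiff_b hτc 1)
      (fun y => by simpa [Fin.sum_univ_two] using h.div_u τ hτc y)
      (fun y => by simpa [Fin.sum_univ_two] using h.div_b τ hτc y) x (hbt x) hwt
    have hft : fderiv ℝ (joint fun τ => density (b 1 τ)) (τ, x) (1, 0)
        = (1 - 7 * b 1 τ x) * deriv (fun s => b 1 s x) τ * pd 0 (pd 0 (b 1 τ)) x ^ 2
        + (b 1 τ x - 7 / 2 * b 1 τ x ^ 2)
          * (2 * pd 0 (pd 0 (b 1 τ)) x * deriv (fun s => spd 0 (spd 0 (b 1)) s x) τ) := by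
      have d1 := (hasDerivAt_time db).differentiableAt.hasDerivAt
      have d2 := (hasDerivAt_time dw).differentiableAt.hasDerivAt
      have d3 := (d1.fun_sub ((d1.fun_pow 2).const_mul (7 / 2))).fun_mul (d2.fun_pow 2)
      rw [← (hasDerivAt_time (differentiableAt_joint sf hτ x)).deriv]
      refine d3.deriv.trans ?_
      simp only [spd, Nat.reduceSub, pow_one, Nat.cast_ofNat]
      ring
    rw [hft, ← pd_eq_fderiv (differentiableAt_joint s1 hτ x),
      ← pd_eq_fderiv (differentiableAt_joint s2 hτ x)]
    exact key.symm
  · refine (h.integrableOn_flux hT ht.2 1 0 enorm_neg_two).congr_fun (fun p _ => ?_)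
      (measurableSet_slab t)
    simp only [joint, flux₂]
    ring

/-- The bound in extended nonnegative numbers for the absolute value of the integral. -/
theorem enorm_integral_main_le (h : IsSmoothSolution T u b P) (hT : 0 < T) {t : ℝ}
    (ht : t ∈ Icc 0 T) :
    ‖∫ p in slab t, pd 1 (u 1 p.1) p.2 * pd 0 (pd 0 (b 1 p.1)) p.2 ^ 2‖ₑ
      ≤ 1100 * E₀ u b t * (APlus u b t + AMinus u b t) ^ (1 / 2 : ℝ)
        + 1100 * (E₀ u b t ^ (1 / 2 : ℝ) + E₀ u b t + E₀ u b t ^ (3 / 2 : ℝ))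
          * (E₀ u b t + E₁ b t) := by
  have i1 := h.integrableOn_main hT ht.2
  have i2 := h.integrableOn_b₁_term hT ht.2
  have i3 := h.integrableOn_remainder hT ht.2
  have bal := h.integral_density_balance hT ht
  have hsum : ∫ p in slab t, (pd 1 (u 1 p.1) p.2 * pd 0 (pd 0 (b 1 p.1)) p.2 ^ 2
        + b 0 p.1 p.2 * pd 0 (u 1 p.1) p.2 * pd 0 (pd 0 (b 1 p.1)) p.2 ^ 2
        + remainder (u 1 p.1) (b 0 p.1) (b 1 p.1) p.2) = _ := integral_add (i1.add i2) i3
  rw [hsum] at bal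
  have hsum2 := integral_add i1 i2
  rw [show _ = _ from hsum2] at bal
  have hmain : ∫ p in slab t, pd 1 (u 1 p.1) p.2 * pd 0 (pd 0 (b 1 p.1)) p.2 ^ 2
      = ((∫ x, density (b 1 t) x) - ∫ x, density (b 1 0) x)
        - ((∫ p in slab t, b 0 p.1 p.2 * pd 0 (u 1 p.1) p.2 * pd 0 (pd 0 (b 1 p.1)) p.2 ^ 2)
        + ∫ p in slab t, remainder (u 1 p.1) (b 0 p.1) (b 1 p.1) p.2) := by
    linarith
  have hb := h.lintegral_b₁_term_le hT ht.2
  have hr := h.lintegral_remainder_le hT ht.2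
  have hd1 := h.lintegral_density_le ht.2 (τ := t) ⟨ht.1, le_rfl⟩
  have hd0 := h.lintegral_density_le ht.2 (τ := 0) ⟨le_rfl, ht.1⟩
  have h32 : E₀ u b t ^ (3 / 2 : ℝ) = (E₀ u b t ^ (1 / 2 : ℝ)) ^ 3 := by
    rw [← ENNReal.rpow_natCast, ← ENNReal.rpow_mul]; norm_num
  have h22 : E₀ u b t = (E₀ u b t ^ (1 / 2 : ℝ)) ^ 2 := (rpow_half_sq _).symm
  rw [h32]
  set e := E₀ u b t ^ (1 / 2 : ℝ)
  set A := (APlus u b t + AMinus u b t) ^ (1 / 2 : ℝ)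
  rw [hmain]
  calc _ ≤ (‖∫ x, density (b 1 t) x‖ₑ + ‖∫ x, density (b 1 0) x‖ₑ)
        + (‖∫ p in slab t, b 0 p.1 p.2 * pd 0 (u 1 p.1) p.2 * pd 0 (pd 0 (b 1 p.1)) p.2 ^ 2‖ₑ
        + ‖∫ p in slab t, remainder (u 1 p.1) (b 0 p.1) (b 1 p.1) p.2‖ₑ) :=
        enorm_sub_le.trans (add_le_add enorm_sub_le (enorm_add_le _ _))
    _ ≤ ((2 * e + 14 * e ^ 2) * E₀ u b t + (2 * e + 14 * e ^ 2) * E₀ u b t)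
        + (2 * E₀ u b t * A + 1000 * (e + e ^ 2 + e ^ 3) * (E₀ u b t + E₁ b t)) := by
        gcongr
        · exact (enorm_integral_le_lintegral_enorm _).trans hd1
        · exact (enorm_integral_le_lintegral_enorm _).trans hd0
        · exact (enorm_integral_le_lintegral_enorm _).trans hb
        · exact (enorm_integral_le_lintegral_enorm _).trans hr
    _ ≤ 1100 * E₀ u b t * A + 1100 * (e + E₀ u b t + e ^ 3) * (E₀ u b t + E₁ b t) := by
        rw [h22]
        -- The added nonnegative quantity is the difference of the two sides.
        refine le_of_le_of_eq (le_add_of_nonneg_right (zero_le :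
          0 ≤ 1098 * e ^ 2 * A + 96 * e ^ 3 + 72 * e ^ 4 + 100 * e ^ 5
            + 100 * (e + e ^ 2 + e ^ 3) * E₁ b t)) ?_
        ring

end IsSmoothSolution

end MHD


theorem proposition2p2 :
    ∃ C : ℝ, 0 < C ∧
      ∀ (T : ℝ) (u b : MHD.VectorField) (P : MHD.ScalarField),
        0 < T → MHD.IsSmoothSolution T u b P →
        ∀ t ∈ Icc 0 T,
          -- all quantities in the estimate are finite and the integral exists
          MHD.E₀ u b t < ∞ ∧ MHD.E₁ b t < ∞ ∧ MHD.APlus u b t < ∞ ∧ MHD.AMinus u b t < ∞ ∧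
          Integrable
            (fun p : ℝ × MHD.Plane =>
              MHD.pd 1 (u 1 p.1) p.2 * |MHD.pd 0 (MHD.pd 0 (b 1 p.1)) p.2| ^ 2)
            ((volume.restrict (Ioc 0 t)).prod volume) ∧
          -- the estimate itself
          ∫ τ in (0 : ℝ)..t, ∫ x : MHD.Plane,
              MHD.pd 1 (u 1 τ) x * |MHD.pd 0 (MHD.pd 0 (b 1 τ)) x| ^ 2
            ≤ C * (MHD.E₀ u b t).toReal *
                ((MHD.APlus u b t).toReal + (MHD.AMinus u b t).toReal) ^ (1 / 2 : ℝ)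
              + C * ((MHD.E₀ u b t).toReal ^ (1 / 2 : ℝ) + (MHD.E₀ u b t).toReal
                  + (MHD.E₀ u b t).toReal ^ (3 / 2 : ℝ))
                * ((MHD.E₀ u b t).toReal + (MHD.E₁ b t).toReal) := by
  refine ⟨1100, by norm_num, fun T u b P hT h t ht => ?_⟩
  have h0 := h.E₀_lt ht.2
  have h1 := h.E₁_lt ht.2
  have hp := h.APlus_lt ht.2
  have hm := h.AMinus_lt ht.2
  have hint := h.integrableOn_main hT ht.2
  have hmeas : (volume.restrict (Ioc 0 t)).prod (volume : Measure MHD.Plane)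
      = volume.restrict (MHD.slab t) := by
    rw [MHD.volume_restrict_slab, Measure.restrict_congr_set Ioc_ae_eq_Icc]
  simp only [sq_abs]
  refine ⟨h0, h1, hp, hm, by rw [hmeas]; exact hint, ?_⟩
  have heq : ∫ τ in (0 : ℝ)..t, ∫ x : MHD.Plane,
      MHD.pd 1 (u 1 τ) x * MHD.pd 0 (MHD.pd 0 (b 1 τ)) x ^ 2
      = ∫ p in MHD.slab t, MHD.pd 1 (u 1 p.1) p.2 * MHD.pd 0 (MHD.pd 0 (b 1 p.1)) p.2 ^ 2 := by
    rw [intervalIntegral.integral_of_le ht.1, ← hmeas, integral_prod]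
    rw [hmeas]; exact hint
  have key := h.enorm_integral_main_le hT ht
  have e1 : MHD.E₀ u b t ^ (1 / 2 : ℝ) < ∞ := h.e_lt ht.2
  have e3 : MHD.E₀ u b t ^ (3 / 2 : ℝ) < ∞ :=
    ENNReal.rpow_lt_top_of_nonneg (by norm_num) h0.ne
  have hA : (MHD.APlus u b t + MHD.AMinus u b t) ^ (1 / 2 : ℝ) < ∞ :=
    ENNReal.rpow_lt_top_of_nonneg (by norm_num) (ENNReal.add_lt_top.2 ⟨hp, hm⟩).ne
  have hle := ENNReal.toReal_mono (by finiteness) key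
  rw [heq]
  refine (le_abs_self _).trans ?_
  rw [toReal_enorm, Real.norm_eq_abs] at hle
  refine hle.trans_eq ?_
  rw [ENNReal.toReal_add (by finiteness) (by finiteness)]
  simp only [ENNReal.toReal_mul]
  rw [ENNReal.toReal_add (a := MHD.E₀ u b t ^ (1 / 2 : ℝ) + MHD.E₀ u b t) (by finiteness)
    (by finiteness), ENNReal.toReal_add (a := MHD.E₀ u b t ^ (1 / 2 : ℝ)) (by finiteness)
    (by finiteness), ENNReal.toReal_add h0.ne h1.ne, ← ENNReal.toReal_rpow, ← ENNReal.toReal_rpow,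
    ← ENNReal.toReal_rpow, ENNReal.toReal_add hp.ne hm.ne]
  simp
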